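/- **Setting.** Let $\mathbb X$ and $\mathbb S$ be finite sets, $s_0\in\mathbb S$, let $\phi:\mathbb X\times\mathbb S\to\mathbb S$ be such that $x\mapsto\phi(x,s)$ is one-to-one for each $s$, and for each $s\in\mathbb S$ let $P(\cdot\mid s)$ be a PMF on $\mathbb X$. The unifilar source with these data emits $x^n$ with probability $P_n(x^n)=\prod_{i=1}^n P(x_i\mid s_{i-1})$, where $s_i=\phi(x_i,s_{i-1})$. Write $s\to t$ if $t=\phi(x,s)$ for some $x$ with $P(x\mid s)>0$. Assume that the source is irreducible up to states visited at most once: every state that can be reached from itself by one or more steps $\to$ can be reached in this way from every state. For a joint PMF $Q$ on $\mathbb S\times\mathbb X$ put $Q(s)=\sum_xQ(x,s)$ and $q(x\mid s)=Q(x,s)/Q(s)$ (and $0$ if $Q(s)=0$), and, with logarithms to base $2$, $$H(Q)=-\sum_{s,x}Q(x,s)\log q(x\mid s),\qquad D(Q\|P)=\sum_{s,x}Q(x,s)\log\frac{q(x\mid s)}{P(x\mid s)},$$ where $D(Q\|P)=\infty$ if $Q(x,s)>0=P(x\mid s)$ for some $(x,s)$. Call $Q$ stationary if $Q(t)=\sum_{(x,s):\,\phi(x,s)=t}Q(x,s)$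 for all $t\in\mathbb S$. A cipher with $k$ key bits consists of an encryption map $f$ from $\mathbb X^n\times\{0,1\}^k$ to the finite binary strings and a decryption map $f^{-1}$ with $f^{-1}(f(x^n,u),u)=x^n$. The message $X^n$ has law $P_n$, the key $U$ is uniform on $\{0,1\}^k$ and independent of $X^n$, and $Y=f(X^n,U)$. Let $G_f(x^n\mid y)$ be the position of $x^n$ when the messages are guessed in decreasing order of the posterior probabilities $\Pr\{X^n=\cdot\mid Y=y\}$, and let $$E_n(k,\rho)=\sup_f\frac1n\log\mathbb E\big[G_f(X^n\mid Y)^\rho\big].$$ **Theorem.** Let $R>0$ and $\rho>0$, and let $k_n$ be the number of key bits at length $n$, with key rate $k_n/n\to R$. Then the limit of $E_n(k_n,\rho)$ exists and $$\lim_{n\to\infty}E_n(k_n,\rho)=E(R,\rho):=\max_Q\big[\rho\min\{H(Q),R\}-D(Q\|P)\big],$$ where the maximum, over all stationary joint PMFs $Q$ on $\mathbb S\times\mathbb X$, is attained and finite. Moreover, the following attack, which uses $\phi$, $s_0$ and the cipher but not $P$, attains this exponent. Let $Q_{x^n}(x,s)=\frac1n\#\{i:x_i=x,\ s_{i-1}=s\}$,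 and list the messages $x^n_1,x^n_2,\dots$ in increasing order of the description length $L_n^*(x^n)=nH(Q_{x^n})+|\mathbb S|(|\mathbb X|-1)\log(n+1)$, with ties broken arbitrarily. List the keys $u_1,u_2,\dots$ in any order. Having observed $y$, guess $x^n_1,f^{-1}(y,u_1),x^n_2,f^{-1}(y,u_2),\dots$, skipping messages already guessed (and going on with the other list when one is exhausted). If $G(x^n\mid y)$ is the resulting number of guesses, then $$\lim_{n\to\infty}\ \sup_f\frac1n\log\mathbb E\big[G(X^n\mid Y)^\rho\big]=E(R,\rho).$$ -/

import Mathlib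

open Filter Topology

noncomputable section

/-! ## The source

`φ a s` is the state that follows state `s` when the letter `a` is emitted, `P s a` is the
probability of the letter `a` in state `s`, and `s₀` is the initial state. -/

/-- The map `φ : 𝕏 × 𝕊 → 𝕊` of a unifilar source: for each state `s`, `x ↦ φ x s` is
one-to-one. -/
def IsUnifilarMap {X S : Type*} (φ : X → S → S) : Prop :=
  ∀ s : S, Function.Injective (fun x : X => φ x s)

/-- `P s` is a probability mass function on the letters, for every state `s`. -/
def IsLetterLaw {X S : Type*} [Fintype X] (P : S → X → ℝ) : Prop :=
  ∀ s : S, (∀ x : X, 0 ≤ P s x) ∧ ∑ x : X, P s x = 1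

/-- The state from which the letter with (zero-based) index `i` of `x` is emitted. -/
def stateBefore {X S : Type*} (φ : X → S → S) (s₀ : S) {n : ℕ} (x : Fin n → X) (i : Fin n) : S :=
  ((List.ofFn x).take i).foldl (fun s a => φ a s) s₀

/-- The probability of the message `x`. -/
def seqProb {X S : Type*} (φ : X → S → S) (s₀ : S) (P : S → X → ℝ) {n : ℕ}
    (x : Fin n → X) : ℝ :=
  ∏ i : Fin n, P (stateBefore φ s₀ x i) (x i)

/-- The state `t` can follow the state `s` with positive probability. -/
def PossibleStep {X S : Type*} (φ : X → S → S) (P : S → X → ℝ) (s t : S) : Prop :=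
  ∃ x : X, 0 < P s x ∧ φ x s = t

/-- Irreducibility, up to states that are visited at most once: every state to which
the source can return with positive probability can be reached, with positive probability, from
every state. -/
def IsIrreducibleSource {X S : Type*} (φ : X → S → S) (P : S → X → ℝ) : Prop :=
  ∀ s t : S, Relation.TransGen (PossibleStep φ P) t t → Relation.TransGen (PossibleStep φ P) s t

/-! ## Conditional entropy and divergence of state-letter PMFs (in bits) -/

/-- `Q` is a joint probability mass function on states and letters. -/
def IsJointPMF {X S : Type*} [Fintype X] [Fintype S] (Q : S → X → ℝ) : Prop :=
  (∀ s x, 0 ≤ Q s x) ∧ ∑ s : S, ∑ x : X, Q s x = 1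

/-- The law of the current state under `Q` is also the law of the next state. -/
def IsStationaryPMF {X S : Type*} [Fintype X] [Fintype S] [DecidableEq S] (φ : X → S → S)
    (Q : S → X → ℝ) : Prop :=
  ∀ t : S, ∑ x : X, Q t x = ∑ s : S, ∑ x : X, if φ x s = t then Q s x else 0

/-- The letter probabilities `q(x | s)` given the state. They are `0` where `Q(s) = 0`. -/
def letterProb {X S : Type*} [Fintype X] (Q : S → X → ℝ) (s : S) (x : X) : ℝ :=
  Q s x / ∑ a : X, Q s a

/-- The conditional entropy `H(Q)`. -/
def condEntropy {X S : Type*} [Fintype X] [Fintype S] (Q : S → X → ℝ) : ℝ :=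
  - ∑ s : S, ∑ x : X, Q s x * Real.logb 2 (letterProb Q s x)

open scoped Classical in
/-- The conditional divergence `D(Q ‖ P)`; it is infinite when `Q` charges a pair to which `P`
gives conditional probability zero. -/
def condDiv {X S : Type*} [Fintype X] [Fintype S] (Q P : S → X → ℝ) : EReal :=
  if ∀ s x, P s x = 0 → Q s x = 0 then
    ((∑ s : S, ∑ x : X, Q s x * Real.logb 2 (letterProb Q s x / P s x) : ℝ) : EReal)
  else ⊤

/-- The values `ρ min {H(Q), R} - D(Q ‖ P)` over all stationary joint PMFs `Q`; the exponent
`E(R, ρ)` is the greatest of them. -/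
def exponentValues {X S : Type*} [Fintype X] [Fintype S] [DecidableEq S] (φ : X → S → S)
    (P : S → X → ℝ) (R ρ : ℝ) : Set EReal :=
  {e | ∃ Q : S → X → ℝ, IsJointPMF Q ∧ IsStationaryPMF φ Q ∧
    e = ((ρ * min (condEntropy Q) R : ℝ) : EReal) - condDiv Q P}

/-! ## The Shannon cipher system -/

/-- An encryption function for messages of length `n` with `k` key bits, with its decryption
function. The cryptogram is a binary string of variable length. -/
structure Cipher (X : Type*) (n k : ℕ) where
  /-- encryption of a message with a key -/
  enc : (Fin n → X) → (Fin k → Bool) → List Bool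
  /-- decryption of a cryptogram with a key -/
  dec : List Bool → (Fin k → Bool) → (Fin n → X)
  dec_enc : ∀ x u, dec (enc x u) u = x

/-- `Pr {X = x, Y = y}` when `X` has law `p` and the key is uniform and independent of `X`. -/
def jointProb {X : Type*} {n k : ℕ} (p : (Fin n → X) → ℝ) (c : Cipher X n k)
    (y : List Bool) (x : Fin n → X) : ℝ :=
  ∑ u : Fin k → Bool, if c.enc x u = y then p x * ((2 : ℝ) ^ k)⁻¹ else 0

/-- The posterior probability `Pr {X = x | Y = y}`. -/
def posterior {X : Type*} [Fintype X] {n k : ℕ} (p : (Fin n → X) → ℝ)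
    (c : Cipher X n k) (y : List Bool) (x : Fin n → X) : ℝ :=
  jointProb p c y x / ∑ a : Fin n → X, jointProb p c y a

open scoped Classical in
/-- The attacker's optimal strategy: `bayesGuess p c y x` is the position of `x` when the messages
are guessed in decreasing order of posterior probability given `y`. Ties are broken by a fixed
enumeration of the messages. -/
def bayesGuess {X : Type*} [Fintype X] {n k : ℕ} (p : (Fin n → X) → ℝ) (c : Cipher X n k)
    (y : List Bool) (x : Fin n → X) : ℕ :=
  (Finset.univ.filter fun a : Fin n → X =>
    posterior p c y x < posterior p c y a ∨
      (posterior p c y a = posterior p c y x ∧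
        Fintype.equivFin (Fin n → X) a ≤ Fintype.equivFin (Fin n → X) x)).card

/-- `𝔼 [G(X | Y) ^ ρ]`, where `G y x` is the number of guesses that the attacker needs when the
cryptogram is `y` and the message is `x`. -/
def guessMoment {X : Type*} [Fintype X] {n k : ℕ} (p : (Fin n → X) → ℝ) (c : Cipher X n k)
    (ρ : ℝ) (G : List Bool → (Fin n → X) → ℕ) : ℝ :=
  ∑ x : Fin n → X, ∑ u : Fin k → Bool,
    p x * ((2 : ℝ) ^ k)⁻¹ * (G (c.enc x u) x : ℝ) ^ ρ

/-- The optimal guessing exponent `E_n` for messages of length `n` with law `p` and `k` key bits: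
the supremum over encryption functions of the normalized logarithm of the `ρ`-th moment of the
number of guesses of the optimal attack. -/
def optimalExponent {X : Type*} [Fintype X] (n k : ℕ) (p : (Fin n → X) → ℝ) (ρ : ℝ) : ℝ :=
  ⨆ c : Cipher X n k, (1 / (n : ℝ)) * Real.logb 2 (guessMoment p c ρ (bayesGuess p c))

/-! ## The universal attack -/

/-- The empirical joint PMF of states and letters along `x`. -/
def empirical {X S : Type*} [DecidableEq X] [DecidableEq S] (φ : X → S → S) (s₀ : S) {n : ℕ}
    (x : Fin n → X) (s : S) (a : X) : ℝ :=
  (1 / (n : ℝ)) * ∑ i : Fin n, if x i = a ∧ stateBefore φ s₀ x i = s then 1 else 0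

/-- The minimum description length of `x`. -/
def descLength {X S : Type*} [Fintype X] [Fintype S] [DecidableEq X] [DecidableEq S]
    (φ : X → S → S) (s₀ : S) {n : ℕ} (x : Fin n → X) : ℝ :=
  n * condEntropy (empirical φ s₀ x)
    + (Fintype.card S : ℝ) * ((Fintype.card X : ℝ) - 1) * Real.logb 2 ((n : ℝ) + 1)

/-- The list `l` contains every element of `α` exactly once. -/
def IsEnumeration {α : Type*} (l : List α) : Prop :=
  l.Nodup ∧ ∀ a : α, a ∈ l

/-- `l` lists all messages of length `n` in the order of increasing description length, with any
rule for ties. -/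
def IsMDLOrder {X S : Type*} [Fintype X] [Fintype S] [DecidableEq X] [DecidableEq S]
    (φ : X → S → S) (s₀ : S) {n : ℕ} (l : List (Fin n → X)) : Prop :=
  IsEnumeration l ∧ l.Pairwise (fun x y => descLength φ s₀ x ≤ descLength φ s₀ y)

/-- Alternate between two lists, starting with the first one; when one list is exhausted,
continue with the other. -/
def interlace {α : Type*} : List α → List α → List α
  | [], l => l
  | a :: as, l => a :: interlace l as
  termination_by l₁ l₂ => l₁.length + l₂.length
  decreasing_by simp +arith

/-- The number of guesses until `x` is guessed by someone who goes through the list `l` and skips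
whatever was guessed before: the number of distinct entries of `l` up to the first
occurrence of `x`. -/
def guessCount {α : Type*} [DecidableEq α] (l : List α) (x : α) : ℕ :=
  (l.take (l.idxOf x + 1)).toFinset.card

/-- The attack that interlaces the message list `ms` with the exhaustive key search in the order
`ks`. -/
def interlacedGuess {X : Type*} [DecidableEq X] {n k : ℕ} (ms : List (Fin n → X))
    (ks : List (Fin k → Bool)) (c : Cipher X n k) (y : List Bool) (x : Fin n → X) : ℕ :=
  guessCount (interlace ms (ks.map fun u => c.dec y u)) x

/-- The exponent of the interlaced attack, against the worst encryption function. -/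
def interlacedExponent {X : Type*} [Fintype X] [DecidableEq X] (n k : ℕ) (p : (Fin n → X) → ℝ)
    (ρ : ℝ) (ms : List (Fin n → X)) (ks : List (Fin k → Bool)) : ℝ :=
  ⨆ c : Cipher X n k, (1 / (n : ℝ)) * Real.logb 2 (guessMoment p c ρ (interlacedGuess ms ks c))

theorem exists_isEnumeration (α : Type*) [Finite α] : ∃ l : List α, IsEnumeration l := by
  have := Fintype.ofFinite α
  exact ⟨Finset.univ.toList, Finset.nodup_toList _, by simp⟩

theorem exists_isMDLOrder {X S : Type*} [Fintype X] [Fintype S] [DecidableEq X] [DecidableEq S]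
    (φ : X → S → S) (s₀ : S) (n : ℕ) : ∃ l : List (Fin n → X), IsMDLOrder φ s₀ l := by
  classical
  obtain ⟨l, hl⟩ := exists_isEnumeration (Fin n → X)
  let r : (Fin n → X) → (Fin n → X) → Prop := fun x y => descLength φ s₀ x ≤ descLength φ s₀ y
  have : Std.Total r := ⟨fun a b => le_total _ _⟩
  have : IsTrans _ r := ⟨fun a b c h h' => le_trans h h'⟩
  refine ⟨l.insertionSort r, ⟨?_, ?_⟩, List.pairwise_insertionSort r l⟩
  · exact (List.perm_insertionSort r l).nodup_iff.mpr hl.1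
  · intro a
    exact (List.perm_insertionSort r l).mem_iff.mpr (hl.2 a)

end

/-! The proof is the method of types for the joint counts of states and letters. A message of type
`Q` and positive probability has probability `2 ^ (-n c)`, where `c` is the cross entropy of `Q`
relative to `P`. The sum of `2 ^ (-n H)` over all messages is only polynomial in `n`
(`sum_rpow_neg_condEntropy_le`), because each term is the probability of a message under the letter
law of its own type and there are polynomially many types.

Upper bound: the interlaced attack needs at most twice the smaller of the position in the message
list and the number of keys, hence at most a polynomial times `2 ^ (n min {H, k/n})` guesses. The
`ρ`-th moment is then a polynomial times `2 ^ (n e)`, with `e` the largest value of `exponentAt`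
over types of possible messages (`guessMoment_interlacedGuess_le`). A path enters and leaves each
state equally often up to one, so long types are nearly stationary, and by compactness `e` exceeds
the maximum over stationary PMFs by at most `ε` (`eventually_exponentAt_empirical_le`). By the
rearrangement inequality the Bayes attack does no worse (`guessMoment_bayesGuess_le`).

Lower bound: a single cipher defeats every attack. A stationary `Q` with connected support obeys a
law of large numbers, giving about `2 ^ (n H)` messages of probability about `2 ^ (-n c)`
(`hasTypicalSets_of_stationary`). They are cut into blocks of size about `min {2 ^ k, 2 ^ (n H)}`
and the key acts by bitwise addition within each block. A cryptogram then leaves the whole block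
open, and distinct guess numbers on a block have a large mean power (`exists_cipher_of_block`). A
maximizer with disconnected support is first mixed with a little of a circulation through all
recurrent states (`exists_connected_approximation`), and irreducibility provides a fixed path to it
from the initial state. -/

noncomputable section

/-! ### Paths, types and the Kraft inequality -/

section Paths

variable {X S : Type*}

theorem stateBefore_cons_zero (φ : X → S → S) (s : S) {n : ℕ} (a : X) (x : Fin n → X) :
    stateBefore φ s (Fin.cons a x : Fin (n + 1) → X) 0 = s := by
  simp [stateBefore]

theorem stateBefore_cons_succ (φ : X → S → S) (s : S) {n : ℕ} (a : X) (x : Fin n → X)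
    (i : Fin n) :
    stateBefore φ s (Fin.cons a x : Fin (n + 1) → X) i.succ = stateBefore φ (φ a s) x i := by
  simp [stateBefore, List.ofFn_succ]

/-- The sum of `f` over the pairs of a state and the letter emitted from it along `x`. -/
def pathSum (φ : X → S → S) (s : S) (f : S → X → ℝ) {n : ℕ} (x : Fin n → X) : ℝ :=
  ∑ i : Fin n, f (stateBefore φ s x i) (x i)

theorem pathSum_cons (φ : X → S → S) (s : S) (f : S → X → ℝ) {n : ℕ} (a : X) (x : Fin n → X) :
    pathSum φ s f (Fin.cons a x : Fin (n + 1) → X) = f s a + pathSum φ (φ a s) f x := by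
  simp [pathSum, Fin.sum_univ_succ, stateBefore_cons_zero, stateBefore_cons_succ]

theorem seqProb_cons (φ : X → S → S) (s : S) (P : S → X → ℝ) {n : ℕ} (a : X) (x : Fin n → X) :
    seqProb φ s P (Fin.cons a x : Fin (n + 1) → X) = P s a * seqProb φ (φ a s) P x := by
  simp [seqProb, Fin.prod_univ_succ, stateBefore_cons_zero, stateBefore_cons_succ]

theorem sum_fin_succ_fun [Fintype X] {n : ℕ} (F : (Fin (n + 1) → X) → ℝ) :
    ∑ x, F x = ∑ a : X, ∑ x : Fin n → X, F (Fin.cons a x) := by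
  rw [← Fintype.sum_prod_type']
  exact (Equiv.sum_comp (Fin.consEquiv fun _ => X) F).symm

theorem seqProb_nonneg {φ : X → S → S} {s : S} {P : S → X → ℝ} (hP : ∀ s x, 0 ≤ P s x) {n : ℕ}
    (x : Fin n → X) : 0 ≤ seqProb φ s P x :=
  Finset.prod_nonneg fun _ _ => hP _ _

theorem sum_seqProb_le_one [Fintype X] (φ : X → S → S) {P : S → X → ℝ} (hP : ∀ s x, 0 ≤ P s x)
    (hP1 : ∀ s, ∑ x, P s x ≤ 1) (n : ℕ) (s : S) :
    ∑ x : Fin n → X, seqProb φ s P x ≤ 1 := by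
  induction n generalizing s with
  | zero => simp [seqProb]
  | succ n ih =>
    rw [sum_fin_succ_fun]
    simp only [seqProb_cons, ← Finset.mul_sum]
    refine le_trans (Finset.sum_le_sum fun a _ => ?_) (hP1 s)
    exact mul_le_of_le_one_right (hP s a) (ih _)

theorem sum_seqProb [Fintype X] (φ : X → S → S) {P : S → X → ℝ} (hP : IsLetterLaw P) (n : ℕ)
    (s : S) : ∑ x : Fin n → X, seqProb φ s P x = 1 := by
  induction n generalizing s with
  | zero => simp [seqProb]
  | succ n ih =>
    rw [sum_fin_succ_fun]
    simp only [seqProb_cons, ← Finset.mul_sum, ih, mul_one, (hP s).2]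

/-- Coboundaries telescope along a path. -/
theorem exists_pathSum_coboundary (φ : X → S → S) (h : S → ℝ) {n : ℕ} (s : S) (x : Fin n → X) :
    ∃ t, pathSum φ s (fun s a => h s - h (φ a s)) x = h s - h t := by
  induction n generalizing s with
  | zero => exact ⟨s, by simp [pathSum]⟩
  | succ n ih =>
    obtain ⟨a, x, rfl⟩ : ∃ a x', x = Fin.cons a x' := ⟨x 0, Fin.tail x, (Fin.cons_self_tail x).symm⟩
    obtain ⟨t, ht⟩ := ih (φ a s) x
    refine ⟨t, ?_⟩
    rw [pathSum_cons, ht]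
    ring

theorem seqProb_eq_rpow {φ : X → S → S} {s : S} {P : S → X → ℝ} {n : ℕ} {x : Fin n → X}
    (h : ∀ i, 0 < P (stateBefore φ s x i) (x i)) :
    seqProb φ s P x = (2 : ℝ) ^ pathSum φ s (fun s a => Real.logb 2 (P s a)) x := by
  rw [pathSum, Real.rpow_sum_of_pos two_pos]
  exact Finset.prod_congr rfl fun i _ => (Real.rpow_logb two_pos (by norm_num) (h i)).symm

/-- Additive functionals, hence log-probabilities, see a message only through its type. -/
theorem pathSum_eq_empirical [Fintype X] [Fintype S] [DecidableEq X] [DecidableEq S]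
    (φ : X → S → S) (s : S) (f : S → X → ℝ) {n : ℕ} (x : Fin n → X) :
    pathSum φ s f x = n * ∑ t, ∑ a, empirical φ s x t a * f t a := by
  rcases Nat.eq_zero_or_pos n with rfl | hn
  · simp [pathSum]
  have hn' : (n : ℝ) ≠ 0 := by positivity
  simp only [empirical, Finset.mul_sum, Finset.sum_mul]
  have : ∀ (t : S) (a : X) (i : Fin n),
      (n : ℝ) * (1 / n * (if x i = a ∧ stateBefore φ s x i = t then 1 else 0) * f t a)
        = if x i = a ∧ stateBefore φ s x i = t then f t a else 0 := by
    intro t a i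
    split_ifs <;> field_simp; simp
  simp only [this]
  rw [Finset.sum_congr rfl fun t _ => Finset.sum_comm, Finset.sum_comm, pathSum]
  refine Finset.sum_congr rfl fun i _ => ?_
  simp [ite_and]

theorem empirical_nonneg [DecidableEq X] [DecidableEq S] (φ : X → S → S) (s : S) {n : ℕ}
    (x : Fin n → X) (t : S) (a : X) :
    0 ≤ empirical φ s x t a := by
  unfold empirical
  refine mul_nonneg (by positivity) (Finset.sum_nonneg fun i _ => ?_)
  split_ifs <;> norm_num

theorem isJointPMF_empirical [Fintype X] [Fintype S] [DecidableEq X] [DecidableEq S]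
    (φ : X → S → S) (s : S) {n : ℕ} (hn : 0 < n) (x : Fin n → X) :
    IsJointPMF (empirical φ s x) := by
  refine ⟨empirical_nonneg φ s x, ?_⟩
  have h := pathSum_eq_empirical φ s (fun _ _ => 1) x
  have hn' : (n : ℝ) ≠ 0 := by positivity
  simp only [pathSum, Finset.sum_const, Finset.card_univ, Fintype.card_fin, nsmul_eq_mul,
    mul_one] at h
  exact (mul_left_cancel₀ hn' (by rw [mul_one]; exact h)).symm

/-- The probability mass that `Q` puts on leaving `t`, less that on entering `t`. -/
def imbalance [Fintype X] [Fintype S] [DecidableEq S]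
    (φ : X → S → S) (Q : S → X → ℝ) (t : S) : ℝ :=
  ∑ x : X, Q t x - ∑ s : S, ∑ x : X, if φ x s = t then Q s x else 0

theorem isStationaryPMF_iff [Fintype X] [Fintype S] [DecidableEq S]
    (φ : X → S → S) (Q : S → X → ℝ) :
    IsStationaryPMF φ Q ↔ ∀ t, imbalance φ Q t = 0 := by
  simp [IsStationaryPMF, imbalance, sub_eq_zero]

/-- Summation by parts: under a stationary `Q` every coboundary has mean zero. -/
theorem sum_mul_imbalance [Fintype X] [Fintype S] [DecidableEq S]
    (φ : X → S → S) (Q : S → X → ℝ) (h : S → ℝ) :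
    ∑ t, h t * imbalance φ Q t = ∑ s, ∑ x, Q s x * (h s - h (φ x s)) := by
  simp only [imbalance, mul_sub, Finset.mul_sum, Finset.sum_sub_distrib]
  congr 1
  · simp only [mul_comm]
  · rw [Finset.sum_comm]
    refine Finset.sum_congr rfl fun s _ => ?_
    rw [Finset.sum_comm]
    refine Finset.sum_congr rfl fun x _ => ?_
    simp [mul_comm]

/-- The coboundary of the indicator of `t` telescopes along the path, leaving only the two end
states. -/
theorem abs_imbalance_empirical_le [Fintype X] [Fintype S] [DecidableEq X] [DecidableEq S]
    (φ : X → S → S) (s : S) {n : ℕ} (x : Fin n → X)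
    (t : S) : |imbalance φ (empirical φ s x) t| ≤ 1 / n := by
  rcases Nat.eq_zero_or_pos n with rfl | hn
  · simp [imbalance, empirical]
  have h1 := sum_mul_imbalance φ (empirical φ s x) (fun u => if u = t then 1 else 0)
  simp only [ite_mul, one_mul, zero_mul, Finset.sum_ite_eq', Finset.mem_univ, if_true] at h1
  obtain ⟨e, he⟩ := exists_pathSum_coboundary φ (fun u => if u = t then (1 : ℝ) else 0) s x
  rw [pathSum_eq_empirical, ← h1] at he
  have hn' : (0 : ℝ) < n := by positivity
  rw [le_div_iff₀ hn', mul_comm, ← abs_of_pos hn', ← abs_mul, he]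
  split_ifs <;> simp

theorem empirical_pos_iff [DecidableEq X] [DecidableEq S] {φ : X → S → S} {s : S} {n : ℕ}
    {x : Fin n → X} {t : S} {a : X} :
    0 < empirical φ s x t a ↔ ∃ i, x i = a ∧ stateBefore φ s x i = t := by
  constructor
  · intro h
    by_contra! h'
    refine h.ne' ?_
    unfold empirical
    rw [Finset.sum_eq_zero, mul_zero]
    intro i _
    rw [if_neg]
    exact fun hi => h' i hi.1 hi.2
  · rintro ⟨i, hi⟩
    have hn : 0 < n := i.pos
    refine mul_pos (by positivity) (Finset.sum_pos' (fun j _ => by split_ifs <;> norm_num)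
      ⟨i, Finset.mem_univ _, by rw [if_pos hi]; norm_num⟩)

/-- The cross entropy of `Q` relative to the letter probabilities `P`. -/
def crossEntropy [Fintype X] [Fintype S] (Q P : S → X → ℝ) : ℝ :=
  -∑ s, ∑ x, Q s x * Real.logb 2 (P s x)

/-- `Q` charges only pairs to which `P` gives positive probability. -/
def SupportedBy (Q P : S → X → ℝ) : Prop := ∀ s x, P s x = 0 → Q s x = 0

theorem letterProb_pos [Fintype X] {Q : S → X → ℝ} (hQ : ∀ s x, 0 ≤ Q s x) {s : S} {x : X} (h : 0 < Q s x) :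
    0 < letterProb Q s x :=
  div_pos h (Finset.sum_pos' (fun a _ => hQ s a) ⟨x, Finset.mem_univ _, h⟩)

theorem letterProb_nonneg [Fintype X] {Q : S → X → ℝ} (hQ : ∀ s x, 0 ≤ Q s x) (s : S) (x : X) :
    0 ≤ letterProb Q s x :=
  div_nonneg (hQ s x) (Finset.sum_nonneg fun a _ => hQ s a)

theorem sum_letterProb_le_one [Fintype X] (Q : S → X → ℝ) (s : S) :
    ∑ x, letterProb Q s x ≤ 1 := by
  simp only [letterProb, ← Finset.sum_div]
  exact div_self_le_one _

theorem seqProb_eq_crossEntropy [Fintype X] [Fintype S] [DecidableEq X] [DecidableEq S]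
    {φ : X → S → S} {s : S} {P : S → X → ℝ} {n : ℕ} {x : Fin n → X}
    (h : ∀ i, 0 < P (stateBefore φ s x i) (x i)) :
    seqProb φ s P x = (2 : ℝ) ^ (-(n * crossEntropy (empirical φ s x) P)) := by
  rw [seqProb_eq_rpow h, pathSum_eq_empirical, crossEntropy]
  ring_nf

theorem seqProb_letterProb_empirical [Fintype X] [Fintype S] [DecidableEq X] [DecidableEq S]
    (φ : X → S → S) (s : S) {n : ℕ} (x : Fin n → X) :
    seqProb φ s (letterProb (empirical φ s x)) x
      = (2 : ℝ) ^ (-(n * condEntropy (empirical φ s x))) :=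
  seqProb_eq_crossEntropy fun i =>
    letterProb_pos (empirical_nonneg φ s x) (empirical_pos_iff.2 ⟨i, rfl, rfl⟩)

theorem seqProb_pos_apply {φ : X → S → S} {s : S} {P : S → X → ℝ} (hP : ∀ s x, 0 ≤ P s x) {n : ℕ}
    {x : Fin n → X} (h : 0 < seqProb φ s P x) (i : Fin n) :
    0 < P (stateBefore φ s x i) (x i) :=
  lt_of_le_of_ne (hP _ _) (Ne.symm (Finset.prod_ne_zero_iff.1 h.ne' i (Finset.mem_univ _)))

theorem supportedBy_empirical [DecidableEq X] [DecidableEq S] {φ : X → S → S} {s : S} {P : S → X → ℝ} (hP : ∀ s x, 0 ≤ P s x)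
    {n : ℕ} {x : Fin n → X} (h : 0 < seqProb φ s P x) : SupportedBy (empirical φ s x) P := by
  intro t a hta
  by_contra hne
  obtain ⟨i, rfl, rfl⟩ := empirical_pos_iff.1 (lt_of_le_of_ne (empirical_nonneg φ s x t a)
    (Ne.symm hne))
  exact (seqProb_pos_apply hP h i).ne' hta

open scoped Classical in
theorem card_image_empirical_le [Fintype X] [Fintype S] [DecidableEq X] [DecidableEq S]
    (φ : X → S → S) (s : S) (n : ℕ) :
    (Finset.univ.image fun x : Fin n → X => empirical φ s x).card
      ≤ (n + 1) ^ (Fintype.card S * Fintype.card X) := by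
  let count : (Fin n → X) → S → X → Fin (n + 1) := fun x t a =>
    ⟨(Finset.univ.filter fun i => x i = a ∧ stateBefore φ s x i = t).card,
      Nat.lt_succ_of_le (by simpa using Finset.card_le_univ (α := Fin n) _)⟩
  let toPMF : (S → X → Fin (n + 1)) → S → X → ℝ := fun N t a => 1 / (n : ℝ) * (N t a : ℕ)
  have hsub : (Finset.univ.image fun x : Fin n → X => empirical φ s x)
      ⊆ Finset.univ.image toPMF := by
    intro Q hQ
    obtain ⟨x, -, rfl⟩ := Finset.mem_image.1 hQ
    refine Finset.mem_image.2 ⟨count x, Finset.mem_univ _, ?_⟩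
    funext t a
    simp [toPMF, count, empirical]
  refine (Finset.card_le_card hsub).trans (Finset.card_image_le.trans ?_)
  simp [Fintype.card_pi, ← pow_mul, mul_comm]

/-- Kraft-type inequality for the empirical entropies. -/
theorem sum_rpow_neg_condEntropy_le [Fintype X] [Fintype S] [DecidableEq X] [DecidableEq S]
    (φ : X → S → S) (s : S) (n : ℕ) :
    ∑ x : Fin n → X, (2 : ℝ) ^ (-(n * condEntropy (empirical φ s x)))
      ≤ ((n : ℝ) + 1) ^ (Fintype.card S * Fintype.card X) := by
  classical
  set I := Finset.univ.image fun x : Fin n → X => empirical φ s x with hI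
  have hI0 : ∀ Q ∈ I, ∀ s x, 0 ≤ Q s x := by
    intro Q hQ
    obtain ⟨x, -, rfl⟩ := Finset.mem_image.1 hQ
    exact empirical_nonneg φ s x
  -- Each term is the probability of `x` under its own type's letter law. Enlarging it to the sum
  -- over all types makes the laws independent of `x`, and each has total mass at most one.
  calc ∑ x : Fin n → X, (2 : ℝ) ^ (-(n * condEntropy (empirical φ s x)))
      ≤ ∑ x : Fin n → X, ∑ Q ∈ I, seqProb φ s (letterProb Q) x := by
        refine Finset.sum_le_sum fun x _ => ?_
        rw [← seqProb_letterProb_empirical]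
        exact Finset.single_le_sum (f := fun Q => seqProb φ s (letterProb Q) x)
          (fun Q hQ => seqProb_nonneg (letterProb_nonneg (hI0 Q hQ)) x)
          (Finset.mem_image_of_mem _ (Finset.mem_univ x))
    _ = ∑ Q ∈ I, ∑ x : Fin n → X, seqProb φ s (letterProb Q) x := Finset.sum_comm
    _ ≤ ∑ Q ∈ I, 1 := Finset.sum_le_sum fun Q hQ =>
        sum_seqProb_le_one φ (letterProb_nonneg (hI0 Q hQ)) (sum_letterProb_le_one Q) n s
    _ = (I.card : ℝ) := by simp
    _ ≤ _ := by exact_mod_cast card_image_empirical_le φ s n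

end Paths

/-! ### Continuity and compactness for the exponent -/

section Exponent

variable {X S : Type*} [Fintype X] [Fintype S]

/-- Joint entropy minus state entropy: this form is continuous even where a state loses all its
mass, although `letterProb` is not. -/
theorem condEntropy_eq_negMulLog {Q : S → X → ℝ} (hQ : ∀ s x, 0 ≤ Q s x) :
    condEntropy Q = (∑ s, (∑ x, Real.negMulLog (Q s x) - Real.negMulLog (∑ x, Q s x)))
      / Real.log 2 := by
  rw [condEntropy, Finset.sum_div, ← Finset.sum_neg_distrib]
  refine Finset.sum_congr rfl fun s _ => ?_
  have : Real.negMulLog (∑ x, Q s x) = ∑ x, -(Q s x * Real.log (∑ a, Q s a)) := by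
    rw [Real.negMulLog, Finset.sum_neg_distrib, ← Finset.sum_mul, neg_mul]
  rw [this, ← Finset.sum_sub_distrib, Finset.sum_div, ← Finset.sum_neg_distrib]
  refine Finset.sum_congr rfl fun x _ => ?_
  rcases (hQ s x).eq_or_lt with h | h
  · simp [← h]
  · have h' : 0 < ∑ a, Q s a := Finset.sum_pos' (fun a _ => hQ s a) ⟨x, Finset.mem_univ _, h⟩
    rw [letterProb, Real.logb, Real.log_div h.ne' h'.ne', Real.negMulLog]
    ring

theorem continuousOn_condEntropy :
    ContinuousOn (condEntropy : (S → X → ℝ) → ℝ) {Q | ∀ s x, 0 ≤ Q s x} := by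
  have : Continuous fun Q : S → X → ℝ =>
      (∑ s, (∑ x, Real.negMulLog (Q s x) - Real.negMulLog (∑ x, Q s x))) / Real.log 2 := by
    have := Real.continuous_negMulLog
    fun_prop
  exact this.continuousOn.congr fun Q hQ => condEntropy_eq_negMulLog hQ

theorem continuous_crossEntropy (P : S → X → ℝ) :
    Continuous fun Q : S → X → ℝ => crossEntropy Q P := by
  unfold crossEntropy
  fun_prop

theorem condDiv_of_supportedBy {Q P : S → X → ℝ} (hQ : ∀ s x, 0 ≤ Q s x) (h : SupportedBy Q P) :
    condDiv Q P = ((crossEntropy Q P - condEntropy Q : ℝ) : EReal) := by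
  rw [condDiv, if_pos (show ∀ s x, P s x = 0 → Q s x = 0 from h), crossEntropy, condEntropy, sub_neg_eq_add, neg_add_eq_sub,
    ← Finset.sum_sub_distrib]
  congr 1
  refine Finset.sum_congr rfl fun s _ => ?_
  rw [← Finset.sum_sub_distrib]
  refine Finset.sum_congr rfl fun x _ => ?_
  by_cases hsx : Q s x = 0
  · simp [hsx]
  · have hp : P s x ≠ 0 := fun h0 => hsx (h s x h0)
    have hq := (letterProb_pos hQ (lt_of_le_of_ne (hQ s x) (Ne.symm hsx))).ne'
    rw [Real.logb_div hq hp]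
    ring

theorem condDiv_of_not_supportedBy {Q P : S → X → ℝ} (h : ¬ SupportedBy Q P) :
    condDiv Q P = ⊤ :=
  if_neg h

/-- The value `ρ min {H(Q), R} - D(Q ‖ P)` for `Q` supported by `P`. -/
def exponentAt (P : S → X → ℝ) (R ρ : ℝ) (Q : S → X → ℝ) : ℝ :=
  ρ * min (condEntropy Q) R + condEntropy Q - crossEntropy Q P

theorem continuousOn_exponentAt (P : S → X → ℝ) (R ρ : ℝ) :
    ContinuousOn (exponentAt P R ρ) {Q | ∀ s x, 0 ≤ Q s x} := by
  have h1 := continuousOn_condEntropy (X := X) (S := S)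
  exact ((continuousOn_const.mul (h1.inf continuousOn_const)).add h1).sub
    (continuous_crossEntropy P).continuousOn

/-- The minimum is 1-Lipschitz in the rate, so the actual rate `k / n` may replace its limit. -/
theorem exponentAt_rate_le (P : S → X → ℝ) {R R' ρ : ℝ} (hρ : 0 ≤ ρ) (Q : S → X → ℝ) :
    exponentAt P R' ρ Q ≤ exponentAt P R ρ Q + ρ * |R' - R| := by
  have h : min (condEntropy Q) R' ≤ min (condEntropy Q) R + |R' - R| := by
    have h1 := le_abs_self (R' - R)
    have h2 := abs_nonneg (R' - R)
    rcases le_total (condEntropy Q) R with h | h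
    · rw [min_eq_left h]
      linarith [min_le_left (condEntropy Q) R']
    · rw [min_eq_right h]
      linarith [min_le_right (condEntropy Q) R']
  unfold exponentAt
  nlinarith [mul_le_mul_of_nonneg_left h hρ]

/-- The joint PMFs supported by `P`. -/
def supportedPMFs (P : S → X → ℝ) : Set (S → X → ℝ) := {Q | IsJointPMF Q ∧ SupportedBy Q P}

theorem isCompact_supportedPMFs (P : S → X → ℝ) : IsCompact (supportedPMFs P) := by
  have hbox : IsCompact (Set.pi Set.univ fun _ : S => Set.pi Set.univ fun _ : X =>
      Set.Icc (0 : ℝ) 1) :=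
    isCompact_univ_pi fun _ => isCompact_univ_pi fun _ => isCompact_Icc
  refine hbox.of_isClosed_subset ?_ ?_
  · have h1 : IsClosed {Q : S → X → ℝ | ∀ s x, 0 ≤ Q s x} := by
      simp only [Set.ofPred_forall]
      exact isClosed_iInter fun s => isClosed_iInter fun x =>
        isClosed_le continuous_const (by fun_prop)
    have h2 : IsClosed {Q : S → X → ℝ | ∑ s, ∑ x, Q s x = 1} :=
      isClosed_eq (by fun_prop) continuous_const
    have h3 : IsClosed {Q : S → X → ℝ | SupportedBy Q P} := by
      simp only [SupportedBy, Set.ofPred_forall]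
      exact isClosed_iInter fun s => isClosed_iInter fun x => isClosed_iInter fun _ =>
        isClosed_eq (by fun_prop) continuous_const
    exact (h1.inter h2).inter h3
  · rintro Q ⟨⟨h0, h1⟩, -⟩ s - x -
    refine ⟨h0 s x, ?_⟩
    rw [← h1]
    exact (Finset.single_le_sum (fun a _ => h0 s a) (Finset.mem_univ x)).trans
      (Finset.single_le_sum (f := fun s => ∑ x, Q s x)
        (fun s _ => Finset.sum_nonneg fun a _ => h0 s a) (Finset.mem_univ s))

variable [DecidableEq S]

theorem continuous_imbalance (φ : X → S → S) (t : S) :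
    Continuous fun Q : S → X → ℝ => imbalance φ Q t := by
  unfold imbalance
  refine Continuous.sub (by fun_prop) ?_
  refine continuous_finsetSum _ fun s _ => continuous_finsetSum _ fun x _ => ?_
  split_ifs <;> fun_prop

/-- A closed set of PMFs supported by `P` that contains no stationary one contains no nearly
stationary one. -/
theorem exists_imbalance_gap (φ : X → S → S) {B : Set (S → X → ℝ)}
    (hB : IsCompact B) (hst : ∀ Q ∈ B, ¬ IsStationaryPMF φ Q) :
    ∃ δ > 0, ∀ Q ∈ B, ∃ t, δ < |imbalance φ Q t| := by
  rcases B.eq_empty_or_nonempty with rfl | hne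
  · exact ⟨1, one_pos, by simp⟩
  obtain ⟨Q₀, hQ₀, hmin⟩ := hB.exists_isMinOn (f := fun Q => ∑ t, |imbalance φ Q t|) hne
    (continuous_finsetSum _ fun t _ => (continuous_imbalance φ t).abs).continuousOn
  have hpos : 0 < ∑ t, |imbalance φ Q₀ t| := by
    have := hst Q₀ hQ₀
    rw [isStationaryPMF_iff] at this
    push Not at this
    obtain ⟨t, ht⟩ := this
    exact Finset.sum_pos' (fun _ _ => abs_nonneg _) ⟨t, Finset.mem_univ _, abs_pos.2 ht⟩
  -- If every state had imbalance at most this, the total would be at most `|S| / (|S| + 1)` times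
  -- its positive minimum.
  refine ⟨(∑ t, |imbalance φ Q₀ t|) / (Fintype.card S + 1), by positivity, fun Q hQ => ?_⟩
  by_contra! hle
  have h1 : ∑ t, |imbalance φ Q₀ t| ≤ ∑ t, |imbalance φ Q t| := hmin hQ
  have h2 := Finset.sum_le_sum fun t (_ : t ∈ Finset.univ) => hle t
  rw [Finset.sum_const, nsmul_eq_mul, Finset.card_univ] at h2
  have h3 := h1.trans h2
  rw [mul_div_assoc', le_div_iff₀ (by positivity)] at h3
  nlinarith

/-- The stationary joint PMFs supported by `P`. -/
def stationaryPMFs (φ : X → S → S) (P : S → X → ℝ) : Set (S → X → ℝ) :=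
  {Q | Q ∈ supportedPMFs P ∧ IsStationaryPMF φ Q}

theorem isCompact_stationaryPMFs (φ : X → S → S) (P : S → X → ℝ) :
    IsCompact (stationaryPMFs φ P) := by
  refine (isCompact_supportedPMFs P).inter_right (t := {Q | IsStationaryPMF φ Q}) ?_
  simp only [isStationaryPMF_iff, Set.ofPred_forall]
  exact isClosed_iInter fun t => isClosed_eq (continuous_imbalance φ t) continuous_const

/-- A PMF not supported by `P` has infinite divergence and contributes `⊥`; on the others the
extended value is the real number `exponentAt`. -/
theorem isGreatest_exponentValues {φ : X → S → S} {P : S → X → ℝ} {R ρ : ℝ} {Q : S → X → ℝ}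
    (hQ : Q ∈ stationaryPMFs φ P)
    (hmax : ∀ Q' ∈ stationaryPMFs φ P, exponentAt P R ρ Q' ≤ exponentAt P R ρ Q) :
    IsGreatest (exponentValues φ P R ρ) (exponentAt P R ρ Q : ℝ) := by
  have key : ∀ Q' ∈ supportedPMFs P, ((ρ * min (condEntropy Q') R : ℝ) : EReal) - condDiv Q' P
      = (exponentAt P R ρ Q' : ℝ) := by
    intro Q' hQ'
    rw [condDiv_of_supportedBy hQ'.1.1 hQ'.2, ← EReal.coe_sub, exponentAt]
    congr 1
    ring
  refine ⟨⟨Q, hQ.1.1, hQ.2, (key Q hQ.1).symm⟩, ?_⟩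
  rintro e ⟨Q', h1, h2, rfl⟩
  by_cases hs : SupportedBy Q' P
  · rw [key Q' ⟨h1, hs⟩]
    exact EReal.coe_le_coe_iff.2 (hmax Q' ⟨⟨h1, hs⟩, h2⟩)
  · rw [condDiv_of_not_supportedBy hs, EReal.sub_top]
    exact bot_le

variable [DecidableEq X]

theorem empirical_mem_supportedPMFs {φ : X → S → S} {s : S} {P : S → X → ℝ}
    (hP : ∀ s x, 0 ≤ P s x) {n : ℕ} (hn : 0 < n) {x : Fin n → X} (h : 0 < seqProb φ s P x) :
    empirical φ s x ∈ supportedPMFs P :=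
  ⟨isJointPMF_empirical φ s hn x, supportedBy_empirical hP h⟩

theorem eventually_empirical_notMem (φ : X → S → S) (s : S)
    {B : Set (S → X → ℝ)} (hB : IsCompact B) (hst : ∀ Q ∈ B, ¬ IsStationaryPMF φ Q) :
    ∀ᶠ n : ℕ in atTop, ∀ x : Fin n → X, empirical φ s x ∉ B := by
  obtain ⟨δ, hδ, hgap⟩ := exists_imbalance_gap φ hB hst
  filter_upwards [tendsto_one_div_atTop_nhds_zero_nat.eventually (gt_mem_nhds hδ)] with n hn x hx
  obtain ⟨t, ht⟩ := hgap _ hx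
  linarith [abs_imbalance_empirical_le φ s x t]

/-- Otherwise the compact set of supported PMFs would eventually contain no types, yet messages of
positive probability exist at every length. -/
theorem stationaryPMFs_nonempty (φ : X → S → S) (s : S) {P : S → X → ℝ} (hP : IsLetterLaw P) :
    (stationaryPMFs φ P).Nonempty := by
  by_contra hemp
  have hst : ∀ Q ∈ supportedPMFs P, ¬ IsStationaryPMF φ Q := fun Q hQ h => hemp ⟨Q, hQ, h⟩
  obtain ⟨n, hn, hn0⟩ := ((eventually_empirical_notMem φ s (isCompact_supportedPMFs P) hst).and
    (eventually_gt_atTop 0)).exists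
  have hP0 : ∀ s x, 0 ≤ P s x := fun s => (hP s).1
  obtain ⟨x, -, hx⟩ : ∃ x ∈ (Finset.univ : Finset (Fin n → X)), 0 < seqProb φ s P x := by
    refine (Finset.sum_pos_iff_of_nonneg fun x _ => seqProb_nonneg hP0 x).1 ?_
    rw [sum_seqProb φ hP n s]
    exact one_pos
  exact hn x (empirical_mem_supportedPMFs hP0 hn0 hx)

theorem exists_maximizer (φ : X → S → S) (s : S) {P : S → X → ℝ} (hP : IsLetterLaw P) (R ρ : ℝ) :
    ∃ Q ∈ stationaryPMFs φ P, ∀ Q' ∈ stationaryPMFs φ P,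
      exponentAt P R ρ Q' ≤ exponentAt P R ρ Q := by
  obtain ⟨Q, hQ, hmax⟩ := (isCompact_stationaryPMFs φ P).exists_isMaxOn
    (stationaryPMFs_nonempty φ s hP)
    ((continuousOn_exponentAt P R ρ).mono fun Q hQ => hQ.1.1.1)
  exact ⟨Q, hQ, fun Q' hQ' => hmax hQ'⟩

/-- The exponents at the types of long messages do not exceed the maximal exponent by much. -/
theorem eventually_exponentAt_empirical_le {φ : X → S → S} (s : S) {P : S → X → ℝ}
    (hP : ∀ s x, 0 ≤ P s x) {R ρ E : ℝ}
    (hE : ∀ Q ∈ stationaryPMFs φ P, exponentAt P R ρ Q ≤ E) {ε : ℝ} (hε : 0 < ε) :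
    ∀ᶠ n : ℕ in atTop, ∀ x : Fin n → X, 0 < seqProb φ s P x →
      exponentAt P R ρ (empirical φ s x) ≤ E + ε := by
  -- The offending PMFs form a compact set without stationary members, which long types must avoid.
  set B : Set (S → X → ℝ) := supportedPMFs P ∩ exponentAt P R ρ ⁻¹' Set.Ici (E + ε) with hBdef
  have hB : IsCompact B := by
    refine (isCompact_supportedPMFs P).of_isClosed_subset ?_ Set.inter_subset_left
    exact ((continuousOn_exponentAt P R ρ).mono fun Q hQ => hQ.1.1).preimage_isClosed_of_isClosed
      (isCompact_supportedPMFs P).isClosed isClosed_Ici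
  have hst : ∀ Q ∈ B, ¬ IsStationaryPMF φ Q := by
    rintro Q ⟨h1, h2⟩ h3
    have := hE Q ⟨h1, h3⟩
    have h2' : E + ε ≤ exponentAt P R ρ Q := h2
    linarith
  filter_upwards [eventually_empirical_notMem φ s hB hst, eventually_gt_atTop 0] with n hn hn0 x hx
  by_contra! hlt
  exact hn x ⟨empirical_mem_supportedPMFs hP hn0 hx, hlt.le⟩

end Exponent

/-! ### Positions in interlaced lists -/

section Lists

variable {α : Type*}

theorem interlace_cons (a : α) (as l : List α) : interlace (a :: as) l = a :: interlace l as := by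
  rw [interlace]

theorem interlace_nil (l : List α) : interlace [] l = l := by
  rw [interlace]

theorem mem_interlace (l₁ l₂ : List α) (x : α) : x ∈ interlace l₁ l₂ ↔ x ∈ l₁ ∨ x ∈ l₂ := by
  induction h : l₁.length + l₂.length generalizing l₁ l₂ with
  | zero =>
    have : l₁ = [] := List.length_eq_zero_iff.1 (by omega)
    simp [this, interlace_nil]
  | succ m ih =>
    cases l₁ with
    | nil => simp [interlace_nil]
    | cons a as =>
      rw [interlace_cons, List.mem_cons, ih l₂ as (by simp at h; omega), List.mem_cons]
      tauto

variable [DecidableEq α]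

theorem idxOf_interlace (l₁ l₂ : List α) (x : α) :
    (x ∈ l₁ → (interlace l₁ l₂).idxOf x ≤ 2 * l₁.idxOf x) ∧
      (x ∈ l₂ → (interlace l₁ l₂).idxOf x ≤ 2 * l₂.idxOf x + 1) := by
  induction h : l₁.length + l₂.length generalizing l₁ l₂ with
  | zero =>
    have h1 : l₁ = [] := List.length_eq_zero_iff.1 (by omega)
    have h2 : l₂ = [] := List.length_eq_zero_iff.1 (by omega)
    simp [h1, h2]
  | succ m ih =>
    cases l₁ with
    | nil =>
      rw [interlace_nil]
      refine ⟨by simp, fun _ => by omega⟩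
    | cons a as =>
      -- The lists swap roles after each guess, so each of the two bounds is derived from the other
      -- one.
      obtain ⟨ih1, ih2⟩ := ih l₂ as (by simp at h; omega)
      rw [interlace_cons]
      by_cases hax : a = x
      · subst hax
        simp
      · rw [List.idxOf_cons_ne _ hax, List.idxOf_cons_ne _ hax]
        refine ⟨fun hx => ?_, fun hx => ?_⟩
        · have := ih2 ((List.mem_cons.1 hx).resolve_left (Ne.symm hax))
          omega
        · have := ih1 hx
          omega

theorem guessCount_le (l : List α) (x : α) : guessCount l x ≤ l.idxOf x + 1 :=
  (List.toFinset_card_le _).trans (List.length_take_le _ _)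

theorem guessCount_le_card [Fintype α] (l : List α) (x : α) : guessCount l x ≤ Fintype.card α :=
  Finset.card_le_univ _

theorem mem_take_idxOf {l : List α} {x : α} (hx : x ∈ l) : x ∈ l.take (l.idxOf x + 1) := by
  rw [List.mem_take_iff_getElem]
  have h := List.idxOf_lt_length_of_mem hx
  exact ⟨l.idxOf x, by omega, List.getElem_idxOf h⟩

theorem guessCount_pos {l : List α} {x : α} (hx : x ∈ l) : 0 < guessCount l x :=
  Finset.card_pos.2 ⟨x, List.mem_toFinset.2 (mem_take_idxOf hx)⟩

theorem guessCount_lt {l : List α} {x y : α} (hy : y ∈ l)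
    (h : l.idxOf x < l.idxOf y) : guessCount l x < guessCount l y := by
  refine Finset.card_lt_card (Finset.ssubset_iff_subset_ne.2 ⟨?_, fun heq => ?_⟩)
  · intro z hz
    rw [List.mem_toFinset] at hz ⊢
    exact List.take_subset_take_left l (by omega) hz
  · have hmem := List.mem_toFinset.2 (mem_take_idxOf hy)
    rw [← heq, List.mem_toFinset, List.mem_take_iff_getElem] at hmem
    obtain ⟨j, hj, hjy⟩ := hmem
    have hjlt : j < l.findIdx (· == y) := by
      have : l.idxOf y = l.findIdx (· == y) := rfl
      omega
    simpa [hjy] using List.not_of_lt_findIdx hjlt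

theorem guessCount_injective {l : List α} (hl : ∀ x, x ∈ l) :
    Function.Injective (guessCount l) := by
  intro x y h
  rcases lt_trichotomy (l.idxOf x) (l.idxOf y) with hlt | heq | hlt
  · exact absurd h (guessCount_lt (hl y) hlt).ne
  · exact (List.idxOf_inj (hl x)).1 heq
  · exact absurd h (guessCount_lt (hl x) hlt).ne'

/-- Everything listed up to `x` has value at most `L x`. Counting all ties makes the bound
independent of the tie rule. -/
theorem idxOf_lt_card_filter_of_pairwise [Fintype α] {l : List α} (hl : IsEnumeration l)
    {L : α → ℝ} (hp : l.Pairwise fun x y => L x ≤ L y) (x : α) :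
    l.idxOf x + 1 ≤ (Finset.univ.filter fun y => L y ≤ L x).card := by
  have hx := List.idxOf_lt_length_of_mem (hl.2 x)
  have hcard : (l.take (l.idxOf x + 1)).toFinset.card = l.idxOf x + 1 := by
    rw [List.toFinset_card_of_nodup (hl.1.sublist (List.take_sublist _ _)), List.length_take]
    omega
  rw [← hcard]
  refine Finset.card_le_card fun y hy => ?_
  rw [List.mem_toFinset, List.mem_take_iff_getElem] at hy
  obtain ⟨j, hj, rfl⟩ := hy
  simp only [Finset.mem_filter, Finset.mem_univ, true_and]
  rcases Nat.lt_or_ge j (l.idxOf x) with h | h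
  · have := List.pairwise_iff_getElem.1 hp j (l.idxOf x) (by omega) hx h
    rwa [List.getElem_idxOf] at this
  · have : j = l.idxOf x := by omega
    subst this
    rw [List.getElem_idxOf]

end Lists

/-! ### Guessing strategies and optimality of the Bayes order -/

section Guessing

variable {X : Type*} {n k : ℕ}

theorem jointProb_nonneg {p : (Fin n → X) → ℝ} (hp : ∀ x, 0 ≤ p x) (c : Cipher X n k)
    (y : List Bool) (x : Fin n → X) : 0 ≤ jointProb p c y x := by
  refine Finset.sum_nonneg fun u _ => ?_
  split_ifs
  · exact mul_nonneg (hp x) (by positivity)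
  · exact le_rfl

theorem interlacedGuess_le_index [DecidableEq X] {ms : List (Fin n → X)} (hms : IsEnumeration ms)
    (ks : List (Fin k → Bool)) (c : Cipher X n k) (y : List Bool) (x : Fin n → X) :
    interlacedGuess ms ks c y x ≤ 2 * (ms.idxOf x + 1) := by
  have h1 := guessCount_le (interlace ms (ks.map fun u => c.dec y u)) x
  have h2 := (idxOf_interlace ms (ks.map fun u => c.dec y u) x).1 (hms.2 x)
  unfold interlacedGuess
  omega

/-- The true key decrypts to `x`, so `x` occurs among the at most `2 ^ k` trial decryptions. -/
theorem interlacedGuess_le_keys [DecidableEq X] (ms : List (Fin n → X))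
    {ks : List (Fin k → Bool)} (hks : IsEnumeration ks) (c : Cipher X n k) (x : Fin n → X)
    (u : Fin k → Bool) : interlacedGuess ms ks c (c.enc x u) x ≤ 2 * 2 ^ k := by
  have hmem : x ∈ ks.map fun v => c.dec (c.enc x u) v :=
    List.mem_map.2 ⟨u, hks.2 u, c.dec_enc x u⟩
  have h1 := guessCount_le (interlace ms (ks.map fun v => c.dec (c.enc x u) v)) x
  have h2 := (idxOf_interlace ms (ks.map fun v => c.dec (c.enc x u) v) x).2 hmem
  have h3 := List.idxOf_lt_length_of_mem hmem
  rw [List.length_map] at h3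
  have h4 : ks.length ≤ 2 ^ k := by
    simpa using hks.1.length_le_card
  unfold interlacedGuess
  omega

variable [Fintype X]

/-- Every message is guessed exactly once, so that the numbers of guesses are `1, …, |𝕏|ⁿ`. -/
def IsGuessing (G : List Bool → (Fin n → X) → ℕ) : Prop :=
  ∀ y, Function.Injective (G y) ∧ ∀ x, 1 ≤ G y x ∧ G y x ≤ Fintype.card (Fin n → X)

/-- The posterior, with ties broken by the enumeration, is a strict linear order, and `bayesGuess`
is the rank in it. -/
theorem isGuessing_bayesGuess (p : (Fin n → X) → ℝ) (c : Cipher X n k) :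
    IsGuessing (bayesGuess p c) := by
  classical
  intro y
  have key : ∀ a b, (posterior p c y b < posterior p c y a ∨
      (posterior p c y a = posterior p c y b ∧
        Fintype.equivFin (Fin n → X) a < Fintype.equivFin (Fin n → X) b)) →
      bayesGuess p c y a < bayesGuess p c y b := by
    intro a b hab
    refine Finset.card_lt_card (Finset.ssubset_iff_of_subset ?_ |>.2 ⟨b, ?_, ?_⟩)
    · intro z hz
      simp only [Finset.mem_filter, Finset.mem_univ, true_and] at hz ⊢
      rcases hab with h | ⟨h, h'⟩ <;> rcases hz with g | ⟨g, g'⟩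
      · exact Or.inl (h.trans g)
      · exact Or.inl (g ▸ h)
      · exact Or.inl (h ▸ g)
      · exact Or.inr ⟨g.trans h, g'.trans h'.le⟩
    · simp
    · simp only [Finset.mem_filter, Finset.mem_univ, true_and, not_or, not_and, not_lt, not_le]
      rcases hab with h | ⟨h, h'⟩
      · exact ⟨h.le, fun e => absurd e h.ne⟩
      · exact ⟨h.ge, fun _ => h'⟩
  refine ⟨fun a b hab => ?_, fun x => ⟨?_, ?_⟩⟩
  · by_contra hne
    have hne' : Fintype.equivFin (Fin n → X) a ≠ Fintype.equivFin (Fin n → X) b :=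
      fun h => hne ((Fintype.equivFin _).injective h)
    rcases lt_trichotomy (posterior p c y a) (posterior p c y b) with h | h | h
    · exact (key b a (Or.inl h)).ne' hab
    · rcases hne'.lt_or_gt with h' | h'
      · exact (key a b (Or.inr ⟨h, h'⟩)).ne hab
      · exact (key b a (Or.inr ⟨h.symm, h'⟩)).ne' hab
    · exact (key a b (Or.inl h)).ne hab
  · exact Finset.card_pos.2 ⟨x, by simp⟩
  · exact Finset.card_le_univ _

theorem bayesGuess_le_of_posterior_lt {p : (Fin n → X) → ℝ} {c : Cipher X n k} {y : List Bool}
    {a b : Fin n → X} (h : posterior p c y a < posterior p c y b) :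
    bayesGuess p c y b ≤ bayesGuess p c y a := by
  refine Finset.card_le_card fun z hz => ?_
  simp only [Finset.mem_filter, Finset.mem_univ, true_and] at hz ⊢
  rcases hz with g | ⟨g, -⟩
  · exact Or.inl (h.trans g)
  · exact Or.inl (g ▸ h)

theorem isGuessing_interlacedGuess [DecidableEq X] {ms : List (Fin n → X)}
    (hms : IsEnumeration ms) (ks : List (Fin k → Bool)) (c : Cipher X n k) :
    IsGuessing (interlacedGuess ms ks c) := by
  intro y
  have hmem : ∀ x, x ∈ interlace ms (ks.map fun u => c.dec y u) := fun x =>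
    (mem_interlace _ _ x).2 (Or.inl (hms.2 x))
  exact ⟨guessCount_injective hmem, fun x => ⟨guessCount_pos (hmem x), guessCount_le_card _ _⟩⟩

/-- Grouping by cryptogram lets optimality be checked for one `y` at a time; only finitely many
cryptograms occur. -/
theorem guessMoment_eq_sum_jointProb (p : (Fin n → X) → ℝ) (c : Cipher X n k) (ρ : ℝ)
    (G : List Bool → (Fin n → X) → ℕ) :
    guessMoment p c ρ G =
      ∑ y ∈ Finset.univ.image fun xu : (Fin n → X) × (Fin k → Bool) => c.enc xu.1 xu.2,
        ∑ x, jointProb p c y x * (G y x : ℝ) ^ ρ := by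
  rw [Finset.sum_comm]
  refine Finset.sum_congr rfl fun x _ => ?_
  simp only [jointProb, Finset.sum_mul]
  rw [Finset.sum_comm]
  refine Finset.sum_congr rfl fun u _ => ?_
  simp only [ite_mul, zero_mul]
  rw [Finset.sum_ite_eq, if_pos]
  exact Finset.mem_image_of_mem _ (Finset.mem_univ (x, u))

/-- The attack in the order of decreasing posterior probability is optimal. -/
theorem guessMoment_bayesGuess_le {p : (Fin n → X) → ℝ} (hp : ∀ x, 0 ≤ p x) (c : Cipher X n k)
    {ρ : ℝ} (hρ : 0 ≤ ρ) {G : List Bool → (Fin n → X) → ℕ} (hG : IsGuessing G) :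
    guessMoment p c ρ (bayesGuess p c) ≤ guessMoment p c ρ G := by
  classical
  rw [guessMoment_eq_sum_jointProb, guessMoment_eq_sum_jointProb]
  refine Finset.sum_le_sum fun y _ => ?_
  have toEquiv : ∀ H : List Bool → (Fin n → X) → ℕ, IsGuessing H →
      ∃ e : (Fin n → X) ≃ Fin (Fintype.card (Fin n → X)), ∀ x, (e x : ℕ) + 1 = H y x := by
    intro H hH
    have hH1 := (hH y).2
    let g : (Fin n → X) → Fin (Fintype.card (Fin n → X)) := fun x =>
      ⟨H y x - 1, by have := hH1 x; omega⟩
    have hg : Function.Injective g := by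
      intro a b hab
      have h1 : H y a - 1 = H y b - 1 := congrArg Fin.val hab
      have h2 := hH1 a
      have h3 := hH1 b
      exact (hH y).1 (by omega)
    refine ⟨Equiv.ofBijective g ((Fintype.bijective_iff_injective_and_card g).2
      ⟨hg, by simp⟩), fun x => ?_⟩
    have := (hH1 x).1
    simp only [Equiv.ofBijective_apply, g]
    omega
  obtain ⟨eB, hB⟩ := toEquiv _ (isGuessing_bayesGuess p c)
  obtain ⟨eG, hGe⟩ := toEquiv _ hG
  have hanti : Antivary (jointProb p c y) fun x => (bayesGuess p c y x : ℝ) ^ ρ := by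
    intro a b hab
    by_contra! hlt
    have hnn := jointProb_nonneg hp c y
    have hsum : 0 < ∑ z, jointProb p c y z :=
      Finset.sum_pos' (fun z _ => hnn z) ⟨b, Finset.mem_univ _, (hnn a).trans_lt hlt⟩
    have hpost : posterior p c y a < posterior p c y b := div_lt_div_of_pos_right hlt hsum
    have := bayesGuess_le_of_posterior_lt hpost
    exact absurd hab (not_lt.2 (Real.rpow_le_rpow (by positivity) (by exact_mod_cast this) hρ))
  -- At fixed `y`, any strategy is the Bayes ranking composed with a permutation, so the
  -- rearrangement inequality applies.
  refine (hanti.sum_mul_le_sum_mul_comp_perm (σ := eG.trans eB.symm)).trans_eq ?_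
  refine Finset.sum_congr rfl fun x _ => ?_
  rw [← hB, ← hGe]
  simp

theorem one_le_guessMoment {p : (Fin n → X) → ℝ} (hp : ∀ x, 0 ≤ p x) (hp1 : ∑ x, p x = 1)
    (c : Cipher X n k) {ρ : ℝ} (hρ : 0 ≤ ρ) {G : List Bool → (Fin n → X) → ℕ}
    (hG : IsGuessing G) : 1 ≤ guessMoment p c ρ G := by
  calc (1 : ℝ) = ∑ x, ∑ _u : Fin k → Bool, p x * ((2 : ℝ) ^ k)⁻¹ := by
        simp only [Finset.sum_const, Finset.card_univ, Fintype.card_pi, Fintype.card_bool,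
          Finset.prod_const, Fintype.card_fin, nsmul_eq_mul, Nat.cast_pow, Nat.cast_ofNat]
        rw [← hp1]
        refine Finset.sum_congr rfl fun x _ => ?_
        field_simp
    _ ≤ _ := by
        refine Finset.sum_le_sum fun x _ => Finset.sum_le_sum fun u _ => ?_
        refine le_mul_of_one_le_right (mul_nonneg (hp x) (by positivity)) ?_
        exact Real.one_le_rpow (by exact_mod_cast ((hG _).2 x).1) hρ

theorem guessMoment_le_of_forall {p : (Fin n → X) → ℝ} (hp : ∀ x, 0 ≤ p x) (c : Cipher X n k)
    {ρ : ℝ} (hρ : 0 ≤ ρ) {G : List Bool → (Fin n → X) → ℕ} {B : (Fin n → X) → ℝ}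
    (hB : ∀ x u, (G (c.enc x u) x : ℝ) ≤ B x) :
    guessMoment p c ρ G ≤ ∑ x, p x * B x ^ ρ := by
  calc guessMoment p c ρ G
      ≤ ∑ x, ∑ _u : Fin k → Bool, p x * ((2 : ℝ) ^ k)⁻¹ * B x ^ ρ := by
        refine Finset.sum_le_sum fun x _ => Finset.sum_le_sum fun u _ => ?_
        refine mul_le_mul_of_nonneg_left ?_ (mul_nonneg (hp x) (by positivity))
        exact Real.rpow_le_rpow (by positivity) (hB x u) hρ
    _ = _ := by
        simp only [Finset.sum_const, Finset.card_univ, Fintype.card_pi, Fintype.card_bool,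
          Finset.prod_const, Fintype.card_fin, nsmul_eq_mul, Nat.cast_pow, Nat.cast_ofNat]
        refine Finset.sum_congr rfl fun x _ => ?_
        field_simp

/-- The exponent of a guessing attack at one encryption function. -/
theorem logb_guessMoment_le {p : (Fin n → X) → ℝ} (hp : ∀ x, 0 ≤ p x) (hp1 : ∑ x, p x = 1)
    (c : Cipher X n k) {ρ : ℝ} (hρ : 0 ≤ ρ) {G : List Bool → (Fin n → X) → ℕ}
    (hG : IsGuessing G) :
    (1 / (n : ℝ)) * Real.logb 2 (guessMoment p c ρ G)
      ≤ (1 / (n : ℝ)) * Real.logb 2 ((Fintype.card (Fin n → X) : ℝ) ^ ρ) := by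
  refine mul_le_mul_of_nonneg_left ?_ (by positivity)
  refine Real.logb_le_logb_of_le (by norm_num)
    (zero_lt_one.trans_le (one_le_guessMoment hp hp1 c hρ hG)) ?_
  refine (guessMoment_le_of_forall hp c hρ (B := fun _ => (Fintype.card (Fin n → X) : ℝ))
    fun x u => by exact_mod_cast ((hG _).2 x).2).trans_eq ?_
  rw [← Finset.sum_mul, hp1, one_mul]

end Guessing

/-! ### The exponent of the interlaced attack -/

section UpperBound

variable {X S : Type*} [Fintype X] [Fintype S] [DecidableEq X] [DecidableEq S]

/-- The position of a message in the list by description length is at most exponential in its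
empirical entropy. -/
theorem idxOf_mdl_le {φ : X → S → S} {s : S} {n : ℕ} {ms : List (Fin n → X)}
    (hms : IsMDLOrder φ s ms) (x : Fin n → X) :
    ((ms.idxOf x + 1 : ℕ) : ℝ) ≤ ((n : ℝ) + 1) ^ (Fintype.card S * Fintype.card X)
      * (2 : ℝ) ^ (n * condEntropy (empirical φ s x)) := by
  set h : (Fin n → X) → ℝ := fun x => n * condEntropy (empirical φ s x) with hh
  have hidx := idxOf_lt_card_filter_of_pairwise hms.1 hms.2 x
  calc ((ms.idxOf x + 1 : ℕ) : ℝ)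
      ≤ ((Finset.univ.filter fun y => descLength φ s y ≤ descLength φ s x).card : ℝ) := by
        exact_mod_cast hidx
    _ = ∑ y ∈ Finset.univ.filter fun y => descLength φ s y ≤ descLength φ s x, (1 : ℝ) := by
        rw [Finset.sum_const, nsmul_eq_mul, mul_one]
    _ ≤ ∑ y ∈ Finset.univ.filter fun y => descLength φ s y ≤ descLength φ s x,
          (2 : ℝ) ^ (-h y) * (2 : ℝ) ^ h x := by
        refine Finset.sum_le_sum fun y hy => ?_
        rw [← Real.rpow_add two_pos]
        refine Real.one_le_rpow (by norm_num) ?_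
        have := (Finset.mem_filter.1 hy).2
        -- The logarithmic term is common to all messages of length `n`, so the order is that of the
        -- empirical entropies.
        simp only [descLength] at this
        simp only [hh]
        linarith
    _ ≤ ∑ y, (2 : ℝ) ^ (-h y) * (2 : ℝ) ^ h x :=
        Finset.sum_le_sum_of_subset_of_nonneg (Finset.filter_subset _ _)
          fun y _ _ => by positivity
    _ = (∑ y, (2 : ℝ) ^ (-h y)) * (2 : ℝ) ^ h x := by rw [Finset.sum_mul]
    _ ≤ _ := mul_le_mul_of_nonneg_right (sum_rpow_neg_condEntropy_le φ s n) (by positivity)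

theorem guessMoment_interlacedGuess_le {φ : X → S → S} {s : S} {P : S → X → ℝ}
    (hP : ∀ s x, 0 ≤ P s x) {n k : ℕ} (hn : 0 < n) {ρ E : ℝ} (hρ : 0 ≤ ρ)
    {ms : List (Fin n → X)} (hms : IsMDLOrder φ s ms) {ks : List (Fin k → Bool)}
    (hks : IsEnumeration ks) (c : Cipher X n k)
    (hE : ∀ x : Fin n → X, 0 < seqProb φ s P x →
      exponentAt P (k / n) ρ (empirical φ s x) ≤ E) :
    guessMoment (seqProb φ s P) c ρ (interlacedGuess ms ks c)
      ≤ (2 * ((n : ℝ) + 1) ^ (Fintype.card S * Fintype.card X)) ^ ρ * (2 : ℝ) ^ (n * E)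
        * ((n : ℝ) + 1) ^ (Fintype.card S * Fintype.card X) := by
  set Z : ℝ := ((n : ℝ) + 1) ^ (Fintype.card S * Fintype.card X) with hZ
  have hZ1 : 1 ≤ Z := one_le_pow₀ (by linarith [n.cast_nonneg (α := ℝ)])
  have hn' : (0 : ℝ) < n := by positivity
  set H : (Fin n → X) → ℝ := fun x => condEntropy (empirical φ s x) with hH
  refine (guessMoment_le_of_forall (seqProb_nonneg hP) c hρ
    (B := fun x => 2 * Z * (2 : ℝ) ^ (n * min (H x) (k / n))) fun x u => ?_).trans ?_
  · have h1 : (interlacedGuess ms ks c (c.enc x u) x : ℝ) ≤ 2 * ((ms.idxOf x + 1 : ℕ) : ℝ) := by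
      exact_mod_cast interlacedGuess_le_index hms.1 ks c _ x
    have h2 : (interlacedGuess ms ks c (c.enc x u) x : ℝ) ≤ 2 * 2 ^ k := by
      exact_mod_cast interlacedGuess_le_keys ms hks c x u
    rcases le_total (H x) (k / n) with h | h
    · rw [min_eq_left h, mul_assoc]
      exact h1.trans (mul_le_mul_of_nonneg_left (idxOf_mdl_le hms x) two_pos.le)
    · rw [min_eq_right h, mul_div_cancel₀ _ hn'.ne', Real.rpow_natCast]
      refine h2.trans (mul_le_mul_of_nonneg_right ?_ (by positivity))
      linarith
  -- Probability times cost is, up to `(2 Z) ^ ρ`, `2 ^ (n exponentAt)` times `2 ^ (-n H)`; the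
  -- Kraft sum absorbs the last factor.
  · calc ∑ x, seqProb φ s P x * (2 * Z * (2 : ℝ) ^ (n * min (H x) (k / n))) ^ ρ
        ≤ ∑ x, ((2 * Z) ^ ρ * (2 : ℝ) ^ (n * E)) * (2 : ℝ) ^ (-(n * H x)) := by
          refine Finset.sum_le_sum fun x _ => ?_
          rcases (seqProb_nonneg hP x : 0 ≤ seqProb φ s P x).eq_or_lt with h0 | h0
          · rw [← h0, zero_mul]
            positivity
          · rw [seqProb_eq_crossEntropy (seqProb_pos_apply hP h0),
              Real.mul_rpow (by positivity) (by positivity), ← Real.rpow_mul two_pos.le]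
            rw [mul_left_comm, mul_assoc ((2 * Z) ^ ρ)]
            refine mul_le_mul_of_nonneg_left ?_ (by positivity)
            rw [← Real.rpow_add two_pos, ← Real.rpow_add two_pos]
            refine Real.rpow_le_rpow_of_exponent_le (by norm_num) ?_
            have := mul_le_mul_of_nonneg_left (hE x h0) hn'.le
            rw [exponentAt] at this
            simp only [hH]
            linarith
      _ = ((2 * Z) ^ ρ * (2 : ℝ) ^ (n * E)) * ∑ x, (2 : ℝ) ^ (-(n * H x)) := by
          rw [Finset.mul_sum]
      _ ≤ _ := mul_le_mul_of_nonneg_left (sum_rpow_neg_condEntropy_le φ s n) (by positivity)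

theorem tendsto_log_div_nat (C d : ℝ) :
    Tendsto (fun n : ℕ => (C + d * Real.logb 2 ((n : ℝ) + 1)) / n) atTop (𝓝 0) := by
  have h1 : Tendsto (fun n : ℕ => C / (n : ℝ)) atTop (𝓝 0) := tendsto_const_div_atTop_nhds_zero_nat C
  have h2 : Tendsto (fun n : ℕ => Real.log ((n : ℝ) + 1) / n) atTop (𝓝 0) := by
    have ha : Tendsto (fun y : ℝ => Real.log y / (1 * y + (-1))) atTop (𝓝 0) := by
      simpa using Real.tendsto_pow_log_div_mul_add_atTop 1 (-1) 1 one_ne_zero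
    have hb : Tendsto (fun n : ℕ => (n : ℝ) + 1) atTop atTop :=
      tendsto_atTop_add_const_right _ _ tendsto_natCast_atTop_atTop
    refine (ha.comp hb).congr fun n => ?_
    simp
  have h3 := h1.add (h2.const_mul (d / Real.log 2))
  rw [mul_zero, add_zero] at h3
  refine h3.congr fun n => ?_
  rw [Real.logb]
  ring

theorem eventually_interlaced_le {φ : X → S → S} (s : S) {P : S → X → ℝ} (hP : IsLetterLaw P)
    {R ρ E : ℝ} (hρ : 0 ≤ ρ) {k : ℕ → ℕ}
    (hk : Tendsto (fun n => (k n : ℝ) / (n : ℝ)) atTop (𝓝 R))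
    (hE : ∀ Q ∈ stationaryPMFs φ P, exponentAt P R ρ Q ≤ E) {ε : ℝ} (hε : 0 < ε) :
    ∀ᶠ n : ℕ in atTop, ∀ (ms : List (Fin n → X)) (ks : List (Fin (k n) → Bool)),
      IsMDLOrder φ s ms → IsEnumeration ks → ∀ c : Cipher X n (k n),
        (1 / (n : ℝ)) * Real.logb 2 (guessMoment (seqProb φ s P) c ρ (interlacedGuess ms ks c))
          ≤ E + ε := by
  have hP0 : ∀ s x, 0 ≤ P s x := fun s => (hP s).1
  set d : ℕ := Fintype.card S * Fintype.card X with hd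
  have hkR : Tendsto (fun n => ρ * |(k n : ℝ) / n - R|) atTop (𝓝 0) := by
    simpa using ((hk.sub_const R).abs).const_mul ρ
  -- The three thirds of `ε` pay for the non-stationarity of types, the key rate differing from `R`,
  -- and the polynomial factors.
  filter_upwards [eventually_exponentAt_empirical_le s hP0 hE (show 0 < ε / 3 by positivity),
    hkR.eventually (gt_mem_nhds (show 0 < ε / 3 by positivity)),
    (tendsto_log_div_nat ρ ((1 + ρ) * d)).eventually (gt_mem_nhds (show 0 < ε / 3 by positivity)),
    eventually_gt_atTop 0] with n h1 h2 h3 hn ms ks hms hks c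
  have hn' : (0 : ℝ) < n := by positivity
  have hle := guessMoment_interlacedGuess_le (E := E + ε / 3 + ε / 3) hP0 hn hρ hms hks c
    fun x hx => (exponentAt_rate_le P hρ _).trans (add_le_add (h1 x hx) h2.le)
  have hpos := zero_lt_one.trans_le (one_le_guessMoment (seqProb_nonneg hP0) (sum_seqProb φ hP n s)
    c hρ (isGuessing_interlacedGuess hms.1 ks c))
  have hlog := Real.logb_le_logb_of_le (by norm_num : (1 : ℝ) < 2) hpos hle
  rw [← hd] at hlog
  have hn1 : (0 : ℝ) < (n : ℝ) + 1 := by positivity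
  rw [Real.logb_mul (by positivity) (by positivity), Real.logb_mul (by positivity) (by positivity),
    Real.logb_rpow_eq_mul_logb_of_pos (by positivity),
    Real.logb_mul (by positivity) (by positivity), Real.logb_rpow two_pos (by norm_num),
    Real.logb_pow, Real.logb_self_eq_one (by norm_num)] at hlog
  rw [one_div, inv_mul_le_iff₀ hn']
  rw [div_lt_iff₀ hn'] at h3
  nlinarith

end UpperBound

/-! ### A cipher that is bad for every attacker -/

section Cipher

/-- Distinct positive integers have a large sum of powers. -/
theorem le_sum_rpow_of_injective {ι : Type*} [Fintype ι] {g : ι → ℕ} (hg : Function.Injective g)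
    (hpos : ∀ i, 1 ≤ g i) {ρ : ℝ} (hρ : 0 ≤ ρ) :
    ((Fintype.card ι : ℝ) / 2) * ((Fintype.card ι : ℝ) / 2) ^ ρ ≤ ∑ i, (g i : ℝ) ^ ρ := by
  classical
  set M := Fintype.card ι with hM
  -- At most half of `M` distinct positive integers lie below `M / 2`; the others give the bound.
  set A : Finset ι := Finset.univ.filter fun i => 2 * g i < M with hA
  have hcardA : 2 * A.card ≤ M := by
    have h1 : A.card ≤ (Finset.Ico 1 ((M + 1) / 2)).card := by
      refine Finset.card_le_card_of_injOn g (fun i hi => ?_) hg.injOn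
      have h := (Finset.mem_filter.1 hi).2
      have h' := hpos i
      simp only [Finset.coe_Ico, Set.mem_Ico]
      omega
    rw [Nat.card_Ico] at h1
    omega
  have hcard : A.card + Aᶜ.card = M := Finset.card_add_card_compl A
  have hc : (M : ℝ) / 2 ≤ Aᶜ.card := by
    rw [div_le_iff₀ two_pos]
    exact_mod_cast (by omega : M ≤ Aᶜ.card * 2)
  calc ((M : ℝ) / 2) * ((M : ℝ) / 2) ^ ρ ≤ Aᶜ.card * ((M : ℝ) / 2) ^ ρ :=
        mul_le_mul_of_nonneg_right hc (by positivity)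
    _ = ∑ _i ∈ Aᶜ, ((M : ℝ) / 2) ^ ρ := by rw [Finset.sum_const, nsmul_eq_mul]
    _ ≤ ∑ i ∈ Aᶜ, (g i : ℝ) ^ ρ := by
        refine Finset.sum_le_sum fun i hi => Real.rpow_le_rpow (by positivity) ?_ hρ
        have : ¬ 2 * g i < M := by simpa [hA] using hi
        rw [div_le_iff₀ two_pos]
        exact_mod_cast (by omega : M ≤ g i * 2)
    _ ≤ ∑ i, (g i : ℝ) ^ ρ :=
        Finset.sum_le_sum_of_subset_of_nonneg (Finset.subset_univ _) fun i _ _ => by positivity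

/-- Bitwise addition of a fixed binary word. -/
def xorEquiv {m : ℕ} (v : Fin m → Bool) : (Fin m → Bool) ≃ (Fin m → Bool) :=
  Function.Involutive.toPerm (fun w i => xor (v i) (w i)) fun w => by
    funext i
    simp

theorem xorEquiv_comm {m : ℕ} (v w : Fin m → Bool) : xorEquiv v w = xorEquiv w v := by
  funext i
  exact Bool.xor_comm _ _

theorem xorEquiv_xorEquiv {m : ℕ} (v w : Fin m → Bool) : xorEquiv v (xorEquiv v w) = w :=
  (xorEquiv v).symm_apply_apply w

/-- Cryptogram length costs nothing, so unary codewords suffice. -/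
theorem exists_injective_codeword (α : Type*) [Finite α] :
    ∃ e : α → List Bool, Function.Injective e := by
  have := Fintype.ofFinite α
  refine ⟨fun x => List.replicate (Fintype.equivFin α x) true, fun a b hab => ?_⟩
  exact (Fintype.equivFin α).injective (Fin.ext (by simpa using hab))

/-- The cipher in which each key permutes the messages. -/
def permCipher {X : Type*} {n k : ℕ} [Nonempty (Fin n → X)] (e : (Fin n → X) → List Bool)
    (he : Function.Injective e) (σ : (Fin k → Bool) → Equiv.Perm (Fin n → X)) : Cipher X n k where
  enc x u := e (σ u x)
  dec y u := (σ u).symm (Function.invFun e y)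
  dec_enc x u := by
    rw [Function.leftInverse_invFun he, Equiv.symm_apply_apply]

variable {X : Type*} [Fintype X]

/-- The first `m` key bits are a one-time pad inside blocks of `2 ^ m` messages of `T`; the other
`j` bits are ignored. The factor `1 / 4` is one half for the part of `T` covered by full blocks and
one half from `le_sum_rpow_of_injective`. -/
theorem exists_cipher_of_block {n m j : ℕ} (T : Finset (Fin n → X)) (hT : 2 ^ m ≤ T.card) :
    ∃ c : Cipher X n (m + j), ∀ (p : (Fin n → X) → ℝ) (p₀ ρ : ℝ)
      (G : List Bool → (Fin n → X) → ℕ), (∀ x, 0 ≤ p x) → (∀ x ∈ T, p₀ ≤ p x) → 0 ≤ p₀ → 0 ≤ ρ →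
      IsGuessing G →
      p₀ * ((T.card : ℝ) / 4) * ((2 : ℝ) ^ m / 2) ^ ρ ≤ guessMoment p c ρ G := by
  classical
  have hTne : T.Nonempty := Finset.card_pos.1 (lt_of_lt_of_le (by positivity) hT)
  have : Nonempty (Fin n → X) := ⟨hTne.choose⟩
  obtain ⟨e, he⟩ := exists_injective_codeword (Fin n → X)
  set L := T.card / 2 ^ m with hL
  have hLT : L * 2 ^ m ≤ T.card := Nat.div_mul_le_self _ _
  have hL2 : T.card ≤ 2 * (L * 2 ^ m) := by
    have h1 : 1 ≤ L := Nat.div_pos hT (by positivity)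
    have h2 : T.card < 2 ^ m * (L + 1) := Nat.lt_mul_div_succ _ (by positivity)
    nlinarith [Nat.mul_le_mul_right (2 ^ m) h1]
  obtain ⟨b⟩ : Nonempty ((Fin L × (Fin m → Bool)) ↪ T) :=
    Function.Embedding.nonempty_of_card_le (by simpa using hLT)
  set β : (Fin L × (Fin m → Bool)) ↪ (Fin n → X) := b.trans (Function.Embedding.subtype _)
    with hβ
  have hβT : ∀ z, β z ∈ T := fun z => (b z).2
  -- Messages outside the blocks are left fixed by every key.
  let σ : (Fin (m + j) → Bool) → Equiv.Perm (Fin n → X) := fun u =>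
    Equiv.Perm.viaEmbedding
      (Equiv.prodCongr (Equiv.refl (Fin L)) (xorEquiv fun i => u (Fin.castAdd j i))) β
  have hσ : ∀ u l v, σ u (β (l, v)) = β (l, xorEquiv (fun i => u (Fin.castAdd j i)) v) := by
    intro u l v
    rw [Equiv.Perm.viaEmbedding_apply]
    rfl
  refine ⟨permCipher e he σ, fun p p₀ ρ G hp hpT hp₀ hρ hG => ?_⟩
  have hblock : ∀ (l : Fin L) (w : Fin m → Bool),
      ((2 : ℝ) ^ m / 2) * ((2 : ℝ) ^ m / 2) ^ ρ
        ≤ ∑ v : Fin m → Bool, (G (e (β (l, w))) (β (l, v)) : ℝ) ^ ρ := by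
    intro l w
    have := le_sum_rpow_of_injective (g := fun v : Fin m → Bool => G (e (β (l, w))) (β (l, v)))
      (fun v v' h => by simpa using β.injective ((hG _).1 h)) (fun v => ((hG _).2 _).1) hρ
    simpa using this
  -- Each message of block `l` is sent to each codeword of that block by exactly `2 ^ j` keys.
  have hkeys : ∀ (l : Fin L) (v : Fin m → Bool),
      ∑ u : Fin (m + j) → Bool, (G (e (σ u (β (l, v)))) (β (l, v)) : ℝ) ^ ρ
        = 2 ^ j * ∑ w : Fin m → Bool, (G (e (β (l, w))) (β (l, v)) : ℝ) ^ ρ := by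
    intro l v
    rw [← (Fin.appendEquiv m j).sum_comp, Fintype.sum_prod_type, Finset.mul_sum]
    rw [← (xorEquiv v).sum_comp]
    refine Finset.sum_congr rfl fun w _ => ?_
    simp only [hσ, Fin.appendEquiv, Equiv.coe_fn_mk, Fin.append_left]
    rw [xorEquiv_comm, xorEquiv_xorEquiv]
    simp
  calc p₀ * ((T.card : ℝ) / 4) * ((2 : ℝ) ^ m / 2) ^ ρ
      ≤ p₀ * ((2 : ℝ) ^ (m + j))⁻¹ *
          (2 ^ j * (L * (2 ^ m * (((2 : ℝ) ^ m / 2) * ((2 : ℝ) ^ m / 2) ^ ρ)))) := by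
        have h1 : (T.card : ℝ) ≤ 2 * (L * 2 ^ m) := by exact_mod_cast hL2
        have h2 : p₀ * ((2 : ℝ) ^ (m + j))⁻¹ *
          (2 ^ j * (L * (2 ^ m * (((2 : ℝ) ^ m / 2) * ((2 : ℝ) ^ m / 2) ^ ρ))))
            = p₀ * ((2 * (L * 2 ^ m)) / 4) * ((2 : ℝ) ^ m / 2) ^ ρ := by
          rw [pow_add]
          field_simp
          ring
        rw [h2]
        gcongr
    _ = p₀ * ((2 : ℝ) ^ (m + j))⁻¹ * (2 ^ j * ∑ _l : Fin L, ∑ _w : Fin m → Bool,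
          ((2 : ℝ) ^ m / 2) * ((2 : ℝ) ^ m / 2) ^ ρ) := by
        simp
    _ ≤ p₀ * ((2 : ℝ) ^ (m + j))⁻¹ * (2 ^ j * ∑ l : Fin L, ∑ w : Fin m → Bool,
          ∑ v : Fin m → Bool, (G (e (β (l, w))) (β (l, v)) : ℝ) ^ ρ) := by
        gcongr with l _ w _
        exact hblock l w
    _ = ∑ z : Fin L × (Fin m → Bool), ∑ u : Fin (m + j) → Bool,
          p₀ * ((2 : ℝ) ^ (m + j))⁻¹ * (G (e (σ u (β z))) (β z) : ℝ) ^ ρ := by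
        rw [Fintype.sum_prod_type]
        simp only [← Finset.mul_sum, hkeys]
        congr 2
        exact Finset.sum_congr rfl fun l _ => Finset.sum_comm
    _ ≤ ∑ z : Fin L × (Fin m → Bool), ∑ u : Fin (m + j) → Bool,
          p (β z) * ((2 : ℝ) ^ (m + j))⁻¹ * (G (e (σ u (β z))) (β z) : ℝ) ^ ρ := by
        gcongr with z _ u _
        exact hpT _ (hβT z)
    _ = ∑ x ∈ Finset.univ.map β, ∑ u : Fin (m + j) → Bool,
          p x * ((2 : ℝ) ^ (m + j))⁻¹ * (G (e (σ u x)) x : ℝ) ^ ρ := by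
        rw [Finset.sum_map]
    _ ≤ ∑ x, ∑ u : Fin (m + j) → Bool,
          p x * ((2 : ℝ) ^ (m + j))⁻¹ * (G (e (σ u x)) x : ℝ) ^ ρ := by
        refine Finset.sum_le_sum_of_subset_of_nonneg (Finset.subset_univ _) fun x _ _ => ?_
        refine Finset.sum_nonneg fun u _ => ?_
        have := hp x
        positivity

/-- A cipher that hides each message of `T` among `min {2 ^ k, |T|}` messages of `T`, up to a
constant factor. -/
theorem exists_cipher_guessMoment_ge {n : ℕ} (k : ℕ) {T : Finset (Fin n → X)} (hT : T.Nonempty)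
    {p : (Fin n → X) → ℝ} (hp : ∀ x, 0 ≤ p x) {p₀ : ℝ} (hp₀ : 0 ≤ p₀) (hpT : ∀ x ∈ T, p₀ ≤ p x)
    {ρ : ℝ} (hρ : 0 ≤ ρ) :
    ∃ c : Cipher X n k, ∀ G : List Bool → (Fin n → X) → ℕ, IsGuessing G →
      p₀ * ((T.card : ℝ) / 4) * (min ((2 : ℝ) ^ k) T.card / 4) ^ ρ ≤ guessMoment p c ρ G := by
  have hcard : T.card ≠ 0 := hT.card_pos.ne'
  -- `m` is the smaller of `k` and the integer part of `log |T|`; rounding loses a factor of at most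
  -- 2.
  obtain ⟨m, j, rfl, hmT, hmin⟩ : ∃ m j, k = m + j ∧ 2 ^ m ≤ T.card ∧
      min ((2 : ℝ) ^ k) T.card ≤ 2 * 2 ^ m := by
    rcases le_total k (Nat.log 2 T.card) with h | h
    · refine ⟨k, 0, rfl, Nat.pow_le_of_le_log hcard h, (min_le_left _ _).trans ?_⟩
      linarith [show (0 : ℝ) < 2 ^ k by positivity]
    · refine ⟨Nat.log 2 T.card, k - Nat.log 2 T.card, by omega, Nat.pow_log_le_self 2 hcard,
        (min_le_right _ _).trans ?_⟩
      have := (Nat.lt_pow_succ_log_self (b := 2) (by norm_num) T.card).le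
      rw [pow_succ] at this
      rw [mul_comm]
      exact_mod_cast this
  obtain ⟨c, hc⟩ := exists_cipher_of_block (j := j) T hmT
  refine ⟨c, fun G hG => le_trans ?_ (hc p p₀ ρ G hp hpT hp₀ hρ hG)⟩
  have : min ((2 : ℝ) ^ (m + j)) T.card / 4 ≤ 2 ^ m / 2 := by linarith
  gcongr

end Cipher

/-! ### The Poisson equation -/

section Poisson

variable {X S : Type*} [Fintype X]

theorem letterProb_pos_iff {Q : S → X → ℝ} (hQ : ∀ s x, 0 ≤ Q s x) {s : S} {x : X} :
    0 < letterProb Q s x ↔ 0 < Q s x := by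
  refine ⟨fun h => lt_of_le_of_ne (hQ s x) fun h0 => ?_, letterProb_pos hQ⟩
  rw [letterProb, ← h0, zero_div] at h
  exact h.false

theorem sum_letterProb {Q : S → X → ℝ} {s : S} (hs : 0 < ∑ x, Q s x) :
    ∑ x, letterProb Q s x = 1 := by
  simp only [letterProb, ← Finset.sum_div]
  exact div_self hs.ne'

variable [Fintype S] [DecidableEq S]

/-- Solvability of the Poisson equation of a finite irreducible stationary chain. -/
theorem exists_poisson_solution {φ : X → S → S} {Q : S → X → ℝ} (hQ : ∀ s x, 0 ≤ Q s x)
    (hst : IsStationaryPMF φ Q)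
    (hconn : ∀ s t, 0 < ∑ x, Q s x → 0 < ∑ x, Q t x → Relation.ReflTransGen (PossibleStep φ Q) s t)
    {F : S → ℝ} (hF : ∑ s, F s = 0) (hF0 : ∀ s, ∑ x, Q s x = 0 → F s = 0) :
    ∃ h : S → ℝ, ∀ s, ∑ x, Q s x * (h s - h (φ x s)) = F s := by
  let L : (S → ℝ) →ₗ[ℝ] (S → ℝ) :=
    { toFun := fun h s => ∑ x, Q s x * (h s - h (φ x s))
      map_add' := by
        intro h h'
        funext s
        simp only [Pi.add_apply, ← Finset.sum_add_distrib]
        exact Finset.sum_congr rfl fun x _ => by ring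
      map_smul' := by
        intro c h
        funext s
        simp only [Pi.smul_apply, smul_eq_mul, RingHom.id_apply, Finset.mul_sum]
        exact Finset.sum_congr rfl fun x _ => by ring }
  by_contra hno
  have hmem : F ∉ LinearMap.range L := by
    rintro ⟨h, hh⟩
    exact hno ⟨h, fun s => congrFun hh s⟩
  -- A functional kills the range but not `F`. It suffices to show that its coefficients `γ` are
  -- constant on the support of `Q`, since `F` has sum zero and vanishes off that support.
  obtain ⟨g, hgF, hg⟩ := Submodule.exists_le_ker_of_notMem hmem
  set γ : S → ℝ := fun s => g fun j => if s = j then 1 else 0 with hγ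
  have hrep : ∀ v, g v = ∑ s, v s * γ s := fun v => by
    simpa using LinearMap.pi_apply_eq_sum_univ g v
  have h1 : ∑ s, (∑ x, Q s x * (γ s - γ (φ x s))) * γ s = 0 := by
    rw [← hrep]
    exact LinearMap.mem_ker.1 (hg ⟨γ, rfl⟩)
  have h2 : ∑ s, ∑ x, Q s x * (γ s ^ 2 - γ (φ x s) ^ 2) = 0 := by
    rw [← sum_mul_imbalance φ Q fun s => γ s ^ 2]
    exact Finset.sum_eq_zero fun t _ => by rw [(isStationaryPMF_iff φ Q).1 hst t, mul_zero]
  -- The Dirichlet form of `γ` vanishes: orthogonality to the image of `γ` itself, plus stationarity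
  -- applied to `γ ^ 2`.
  have h3 : ∑ s, ∑ x, Q s x * (γ s - γ (φ x s)) ^ 2 = 0 := by
    have : ∑ s, ∑ x, Q s x * (γ s - γ (φ x s)) ^ 2
        = 2 * ∑ s, (∑ x, Q s x * (γ s - γ (φ x s))) * γ s
          - ∑ s, ∑ x, Q s x * (γ s ^ 2 - γ (φ x s) ^ 2) := by
      simp only [Finset.mul_sum, Finset.sum_mul, ← Finset.sum_sub_distrib]
      exact Finset.sum_congr rfl fun s _ => Finset.sum_congr rfl fun x _ => by ring
    rw [this, h1, h2]
    ring
  have hstep : ∀ s t, PossibleStep φ Q s t → γ s = γ t := by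
    rintro s t ⟨x, hx, rfl⟩
    have hnn : ∀ s x, 0 ≤ Q s x * (γ s - γ (φ x s)) ^ 2 := fun s x =>
      mul_nonneg (hQ s x) (sq_nonneg _)
    have h4 := (Finset.sum_eq_zero_iff_of_nonneg fun s _ =>
      Finset.sum_nonneg fun x _ => hnn s x).1 h3 s (Finset.mem_univ s)
    have h5 := (Finset.sum_eq_zero_iff_of_nonneg fun x _ => hnn s x).1 h4 x (Finset.mem_univ x)
    have h6 := (mul_eq_zero.1 h5).resolve_left hx.ne'
    exact sub_eq_zero.1 (pow_eq_zero_iff two_ne_zero |>.1 h6)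
  have hpath : ∀ s t, Relation.ReflTransGen (PossibleStep φ Q) s t → γ s = γ t := by
    intro s t h
    induction h with
    | refl => rfl
    | tail _ hbc ih => exact ih.trans (hstep _ _ hbc)
  refine hgF ?_
  rw [hrep]
  by_cases hA : ∃ t, 0 < ∑ x, Q t x
  · obtain ⟨t, ht⟩ := hA
    have : ∀ s, F s * γ s = F s * γ t := by
      intro s
      rcases (Finset.sum_nonneg fun x _ => hQ s x : 0 ≤ ∑ x, Q s x).eq_or_lt with h0 | h0
      · rw [hF0 s h0.symm, zero_mul, zero_mul]
      · rw [hpath s t (hconn s t h0 ht)]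
    simp only [this, ← Finset.sum_mul, hF, zero_mul]
  · push Not at hA
    refine Finset.sum_eq_zero fun s _ => ?_
    rw [hF0 s (le_antisymm (hA s) (Finset.sum_nonneg fun x _ => hQ s x)), zero_mul]

theorem state_pos_of_stationary {φ : X → S → S} {Q : S → X → ℝ} (hQ : ∀ s x, 0 ≤ Q s x)
    (hst : IsStationaryPMF φ Q) {s : S} {x : X} (h : 0 < Q s x) : 0 < ∑ a, Q (φ x s) a := by
  rw [hst]
  have hnn : ∀ s' x', 0 ≤ if φ x' s' = φ x s then Q s' x' else 0 := by
    intro s' x'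
    split_ifs
    · exact hQ _ _
    · exact le_rfl
  refine Finset.sum_pos' (fun s' _ => Finset.sum_nonneg fun x' _ => hnn s' x')
    ⟨s, Finset.mem_univ s, Finset.sum_pos' (fun x' _ => hnn s x') ⟨x, Finset.mem_univ x, ?_⟩⟩
  simpa using h

end Poisson

/-! ### Weak law of large numbers -/

section LawOfLargeNumbers

variable {X S : Type*}

theorem pathSum_sub_const (φ : X → S → S) (s : S) (f : S → X → ℝ) (h : S → ℝ) (m : ℝ) {n : ℕ}
    (x : Fin n → X) :
    pathSum φ s (fun s a => f s a - m - (h s - h (φ a s))) x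
      = pathSum φ s f x - n * m - pathSum φ s (fun s a => h s - h (φ a s)) x := by
  simp [pathSum, Finset.sum_sub_distrib]

variable [Fintype X]

/-- Moments of an additive functional whose increments have mean zero in each state. -/
theorem moments_of_martingale {φ : X → S → S} {q : S → X → ℝ} (hq : ∀ s x, 0 ≤ q s x)
    {A : Set S} (hA1 : ∀ s ∈ A, ∑ x, q s x = 1) (hA : ∀ s ∈ A, ∀ x, 0 < q s x → φ x s ∈ A)
    {W : S → X → ℝ} (hW : ∀ s ∈ A, ∑ x, q s x * W s x = 0) {C : ℝ} (hC : ∀ s x, W s x ^ 2 ≤ C)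
    (n : ℕ) {s : S} (hs : s ∈ A) :
    ∑ x : Fin n → X, seqProb φ s q x = 1 ∧
      ∑ x : Fin n → X, seqProb φ s q x * pathSum φ s W x = 0 ∧
      ∑ x : Fin n → X, seqProb φ s q x * pathSum φ s W x ^ 2 ≤ n * C := by
  induction n generalizing s with
  | zero => simp [seqProb, pathSum]
  | succ n ih =>
    -- Letters that lead out of `A` have probability zero and need no induction hypothesis.
    have hstep : ∀ a, ∀ (G H : ℝ), (φ a s ∈ A → G = H) → q s a * G = q s a * H := by
      intro a G H h
      rcases (hq s a).eq_or_lt with h0 | h0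
      · rw [← h0, zero_mul, zero_mul]
      · rw [h (hA s hs a h0)]
    simp only [sum_fin_succ_fun, seqProb_cons, pathSum_cons]
    refine ⟨?_, ?_, ?_⟩
    · rw [← hA1 s hs]
      refine Finset.sum_congr rfl fun a _ => ?_
      rw [← Finset.mul_sum, hstep a _ 1 fun ha => (ih ha).1, mul_one]
    · rw [← hW s hs]
      refine Finset.sum_congr rfl fun a _ => ?_
      simp only [mul_assoc, ← Finset.mul_sum, mul_add, Finset.sum_add_distrib]
      rw [← mul_add]
      refine hstep a _ _ fun ha => ?_
      rw [← Finset.sum_mul, (ih ha).1, (ih ha).2.1]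
      ring
    · calc ∑ a, ∑ x : Fin n → X, q s a * seqProb φ (φ a s) q x *
            (W s a + pathSum φ (φ a s) W x) ^ 2
          ≤ ∑ a, q s a * (C + n * C) := by
            refine Finset.sum_le_sum fun a _ => ?_
            simp only [mul_assoc, ← Finset.mul_sum]
            rcases (hq s a).eq_or_lt with h0 | h0
            · rw [← h0, zero_mul, zero_mul]
            · refine mul_le_mul_of_nonneg_left ?_ h0.le
              obtain ⟨i1, i2, i3⟩ := ih (hA s hs a h0)
              have : ∑ x : Fin n → X, seqProb φ (φ a s) q x * (W s a + pathSum φ (φ a s) W x) ^ 2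
                  = W s a ^ 2 * ∑ x : Fin n → X, seqProb φ (φ a s) q x
                    + 2 * W s a * ∑ x : Fin n → X, seqProb φ (φ a s) q x * pathSum φ (φ a s) W x
                    + ∑ x : Fin n → X, seqProb φ (φ a s) q x * pathSum φ (φ a s) W x ^ 2 := by
                simp only [Finset.mul_sum, ← Finset.sum_add_distrib]
                exact Finset.sum_congr rfl fun x _ => by ring
              rw [this, i1, i2]
              linarith [hC s a]
        _ = ((n + 1 : ℕ) : ℝ) * C := by
            rw [← Finset.sum_mul, hA1 s hs]
            push_cast
            ring

theorem exists_abs_le {α : Type*} [Fintype α] (h : α → ℝ) : ∃ B, 0 ≤ B ∧ ∀ a, |h a| ≤ B :=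
  ⟨∑ a, |h a|, Finset.sum_nonneg fun _ _ => abs_nonneg _, fun a =>
    Finset.single_le_sum (fun b _ => abs_nonneg (h b)) (Finset.mem_univ a)⟩

variable [Fintype S] [DecidableEq S]

/-- Weak law of large numbers for additive functionals of the chain with letter law
`letterProb Q`. -/
theorem eventually_deviation_le {φ : X → S → S} {Q : S → X → ℝ} (hQ : IsJointPMF Q)
    (hst : IsStationaryPMF φ Q)
    (hconn : ∀ s t, 0 < ∑ x, Q s x → 0 < ∑ x, Q t x → Relation.ReflTransGen (PossibleStep φ Q) s t)
    (f : S → X → ℝ) {s : S} (hs : 0 < ∑ x, Q s x) {ε δ : ℝ} (hε : 0 < ε) (hδ : 0 < δ) :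
    ∀ᶠ n : ℕ in atTop,
      ∑ x : Fin n → X with n * ε ≤ |pathSum φ s f x - n * ∑ t, ∑ a, Q t a * f t a|,
        seqProb φ s (letterProb Q) x ≤ δ := by
  set m := ∑ t, ∑ a, Q t a * f t a with hm
  have hq := letterProb_nonneg hQ.1
  -- Subtracting the coboundary of `h` from the centred `f` leaves increments of mean zero in each
  -- charged state.
  obtain ⟨h, hh⟩ := exists_poisson_solution (φ := φ) hQ.1 hst hconn
    (F := fun s => ∑ a, Q s a * (f s a - m))
    (by simp only [mul_sub, Finset.sum_sub_distrib, ← Finset.sum_mul, hQ.2, one_mul, hm, sub_self])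
    (fun t ht => Finset.sum_eq_zero fun a ha => by
      rw [(Finset.sum_eq_zero_iff_of_nonneg fun a _ => hQ.1 t a).1 ht a ha, zero_mul])
  set W : S → X → ℝ := fun s a => f s a - m - (h s - h (φ a s)) with hW
  obtain ⟨B, hB0, hB⟩ := exists_abs_le h
  obtain ⟨D, hD0, hD⟩ := exists_abs_le fun z : S × X => W z.1 z.2
  have hmart : ∀ t ∈ {t | 0 < ∑ x, Q t x}, ∑ x, letterProb Q t x * W t x = 0 := by
    intro t ht
    have h0 : ∑ x, Q t x * W t x = 0 := by
      simp only [hW, mul_sub] at hh ⊢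
      have := hh t
      simp only [Finset.sum_sub_distrib] at this ⊢
      linarith
    simp only [letterProb, div_mul_eq_mul_div, ← Finset.sum_div, h0, zero_div]
  -- The first threshold makes the coboundary at most `n ε / 2`; the second makes the Chebyshev
  -- bound at that level at most `δ`.
  filter_upwards [eventually_ge_atTop ⌈4 * B / ε⌉₊, eventually_ge_atTop ⌈4 * D ^ 2 / (ε ^ 2 * δ)⌉₊,
    eventually_gt_atTop 0] with n hn1 hn2 hn0
  have hn : (0 : ℝ) < n := by positivity
  have h1 : 4 * B ≤ n * ε := (div_le_iff₀ hε).1 (Nat.ceil_le.1 hn1)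
  have h2 : 4 * D ^ 2 ≤ n * (ε ^ 2 * δ) := (div_le_iff₀ (by positivity)).1 (Nat.ceil_le.1 hn2)
  obtain ⟨-, -, hvar⟩ := moments_of_martingale (φ := φ) hq (A := {t | 0 < ∑ x, Q t x})
    (fun t ht => sum_letterProb ht)
    (fun t _ x hx => state_pos_of_stationary hQ.1 hst ((letterProb_pos_iff hQ.1).1 hx)) hmart
    (C := D ^ 2) (fun t a => sq_le_sq' (abs_le.1 (hD (t, a))).1 (abs_le.1 (hD (t, a))).2) n hs
  have hcheb : (n * ε / 2) ^ 2 *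
      ∑ x : Fin n → X with n * ε ≤ |pathSum φ s f x - n * m|, seqProb φ s (letterProb Q) x
        ≤ n * D ^ 2 := by
    refine le_trans ?_ hvar
    rw [Finset.mul_sum]
    refine (Finset.sum_le_sum fun x hx => ?_).trans
      (Finset.sum_le_sum_of_subset_of_nonneg (Finset.filter_subset _ _)
        fun x _ _ => mul_nonneg (seqProb_nonneg hq x) (sq_nonneg _))
    rw [mul_comm]
    refine mul_le_mul_of_nonneg_left ?_ (seqProb_nonneg hq x)
    have hx' := (Finset.mem_filter.1 hx).2
    obtain ⟨t, ht⟩ := exists_pathSum_coboundary φ h s x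
    have hWx : pathSum φ s W x = pathSum φ s f x - n * m - (h s - h t) := by
      rw [← ht, hW, pathSum_sub_const]
    have hst' : |h s - h t| ≤ 2 * B := (abs_sub _ _).trans (by linarith [hB s, hB t])
    rw [← sq_abs (pathSum φ s W x)]
    refine pow_le_pow_left₀ (by positivity) ?_ 2
    rw [hWx]
    have := abs_sub_abs_le_abs_sub (pathSum φ s f x - n * m) (h s - h t)
    linarith
  have hmass : 0 ≤ ∑ x : Fin n → X with n * ε ≤ |pathSum φ s f x - n * m|,
      seqProb φ s (letterProb Q) x := Finset.sum_nonneg fun x _ => seqProb_nonneg hq x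
  refine le_of_mul_le_mul_left (a := (n * ε / 2) ^ 2) (hcheb.trans ?_) (by positivity)
  nlinarith [mul_le_mul_of_nonneg_left h2 hn.le]

end LawOfLargeNumbers

/-! ### Typical sets -/

section TypicalSets

variable {X S : Type*}

/-- From the state `s`, there are about `2 ^ (n a)` messages of length `n`, of probability not much
below `2 ^ (-n b)` each. -/
def HasTypicalSets (φ : X → S → S) (P : S → X → ℝ) (a b : ℝ) (s : S) : Prop :=
  ∀ ε > 0, ∀ᶠ n : ℕ in atTop, ∃ T : Finset (Fin n → X), (2 : ℝ) ^ (n * (a - ε)) ≤ T.card ∧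
    ∀ x ∈ T, (2 : ℝ) ^ (-(n * (b + ε))) ≤ seqProb φ s P x

/-- Prefixing one possible letter costs a constant factor and one unit of length, which half of `ε`
absorbs. -/
theorem HasTypicalSets.of_step {φ : X → S → S} {P : S → X → ℝ} {a b : ℝ} {s t : S}
    (h : PossibleStep φ P s t) (ht : HasTypicalSets φ P a b t) : HasTypicalSets φ P a b s := by
  classical
  obtain ⟨c, hc, rfl⟩ := h
  intro ε hε
  rw [← Filter.map_add_atTop_eq_nat 1, eventually_map]
  have hlin : Tendsto (fun n : ℕ => (n : ℝ) * (ε / 2)) atTop atTop :=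
    tendsto_natCast_atTop_atTop.atTop_mul_const (by positivity)
  filter_upwards [ht (ε / 2) (by positivity), hlin.eventually_ge_atTop (a - ε),
    hlin.eventually_ge_atTop (-(b + ε) - Real.logb 2 (P s c))] with n ⟨T, hT, hTp⟩ h1 h2
  let e : (Fin n → X) ↪ (Fin (n + 1) → X) :=
    ⟨fun x => Fin.cons c x, Fin.cons_right_injective (α := fun _ => X) c⟩
  refine ⟨T.map e, ?_, fun x hx => ?_⟩
  · rw [Finset.card_map]
    refine le_trans (Real.rpow_le_rpow_of_exponent_le (by norm_num) ?_) hT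
    push_cast
    linarith
  · obtain ⟨x, hxT, rfl⟩ := Finset.mem_map.1 hx
    change _ ≤ seqProb φ s P (Fin.cons c x : Fin (n + 1) → X)
    rw [seqProb_cons]
    refine le_trans ?_ (mul_le_mul_of_nonneg_left (hTp x hxT) hc.le)
    rw [← Real.rpow_logb two_pos (by norm_num) hc, ← Real.rpow_add two_pos]
    refine Real.rpow_le_rpow_of_exponent_le (by norm_num) ?_
    push_cast
    linarith

theorem HasTypicalSets.of_reachable {φ : X → S → S} {P : S → X → ℝ} {a b : ℝ} {s t : S}
    (h : Relation.TransGen (PossibleStep φ P) s t) (ht : HasTypicalSets φ P a b t) :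
    HasTypicalSets φ P a b s := by
  induction h using Relation.TransGen.head_induction_on with
  | single h => exact ht.of_step h
  | head h _ ih => exact ih.of_step h

variable [Fintype X] [Fintype S] [DecidableEq S]

/-- Draw messages with the letter law of `Q`. By the law of large numbers half the mass has typical
log-probability under both laws: under `Q` this bounds the number of messages from below, under `P`
their probabilities. -/
theorem hasTypicalSets_of_stationary {φ : X → S → S} {P Q : S → X → ℝ} (hP : ∀ s x, 0 ≤ P s x)
    (hQ : Q ∈ stationaryPMFs φ P)
    (hconn : ∀ s t, 0 < ∑ x, Q s x → 0 < ∑ x, Q t x → Relation.ReflTransGen (PossibleStep φ Q) s t)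
    {s : S} (hs : 0 < ∑ x, Q s x) :
    HasTypicalSets φ P (condEntropy Q) (crossEntropy Q P) s := by
  classical
  obtain ⟨⟨hpmf, hsupp⟩, hst⟩ := hQ
  have hq := letterProb_nonneg hpmf.1
  intro ε hε
  have hlin : Tendsto (fun n : ℕ => (n : ℝ) * (ε / 2)) atTop atTop :=
    tendsto_natCast_atTop_atTop.atTop_mul_const (by positivity)
  filter_upwards [eventually_deviation_le hpmf hst hconn
      (fun s a => Real.logb 2 (letterProb Q s a)) hs (half_pos hε) (show (0 : ℝ) < 1 / 4 by norm_num),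
    eventually_deviation_le hpmf hst hconn
      (fun s a => Real.logb 2 (P s a)) hs hε (show (0 : ℝ) < 1 / 4 by norm_num),
    hlin.eventually_ge_atTop 1] with n h1 h2 h3
  set μ : (Fin n → X) → ℝ := seqProb φ s (letterProb Q) with hμ
  have hμ0 : ∀ x, 0 ≤ μ x := seqProb_nonneg hq
  have hμ1 : ∑ x, μ x = 1 := (moments_of_martingale (φ := φ) hq (A := {t | 0 < ∑ x, Q t x})
    (fun t ht => sum_letterProb ht)
    (fun t _ x hx => state_pos_of_stationary hpmf.1 hst ((letterProb_pos_iff hpmf.1).1 hx))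
    (W := fun _ _ => 0) (by simp) (C := 0) (by simp) n hs).1
  set D₁ : Finset (Fin n → X) := Finset.univ.filter fun x => n * (ε / 2) ≤
    |pathSum φ s (fun s a => Real.logb 2 (letterProb Q s a)) x
      - n * ∑ t, ∑ a, Q t a * Real.logb 2 (letterProb Q t a)| with hD₁
  set D₂ : Finset (Fin n → X) := Finset.univ.filter fun x => n * ε ≤
    |pathSum φ s (fun s a => Real.logb 2 (P s a)) x
      - n * ∑ t, ∑ a, Q t a * Real.logb 2 (P t a)| with hD₂
  -- Null messages are excluded because `Real.logb 2 0 = 0` would make their path sums meaningless.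
  set T : Finset (Fin n → X) := Finset.univ.filter fun x => 0 < μ x ∧ x ∉ D₁ ∧ x ∉ D₂ with hT
  have hmass : 1 / 2 ≤ ∑ x ∈ T, μ x := by
    have hle : ∑ x, μ x ≤ ∑ x ∈ T, μ x + ∑ x ∈ D₁, μ x + ∑ x ∈ D₂, μ x := by
      simp only [← Finset.sum_filter_add_sum_filter_not Finset.univ (· ∈ T) μ]
      rw [Finset.filter_mem_eq_inter, Finset.univ_inter, add_assoc]
      refine add_le_add_right ?_ _
      have hsub : ∑ x ∈ Finset.univ.filter fun x => x ∉ T, μ x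
          = ∑ x ∈ Finset.univ.filter fun x => x ∉ T ∧ 0 < μ x, μ x := by
        rw [← Finset.filter_filter]
        refine (Finset.sum_filter_of_ne fun x _ hx => ?_).symm
        exact lt_of_le_of_ne (hμ0 x) (Ne.symm hx)
      rw [hsub]
      refine le_trans (Finset.sum_le_sum_of_subset_of_nonneg (t := D₁ ∪ D₂) ?_ fun x _ _ => hμ0 x) ?_
      · intro x hx
        simp only [hT, Finset.mem_filter, Finset.mem_univ, true_and, not_and, not_not] at hx
        rw [Finset.mem_union]
        by_contra! hno
        exact hno.2 (hx.1 hx.2 hno.1)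
      · rw [← Finset.sum_union_inter]
        exact le_add_of_nonneg_right (Finset.sum_nonneg fun x _ => hμ0 x)
    linarith
  have hpos : ∀ x ∈ T, ∀ i, 0 < letterProb Q (stateBefore φ s x i) (x i) := fun x hx =>
    seqProb_pos_apply hq (Finset.mem_filter.1 hx).2.1
  refine ⟨T, ?_, fun x hx => ?_⟩
  · have hup : ∀ x ∈ T, μ x ≤ (2 : ℝ) ^ (-(n * (condEntropy Q - ε / 2))) := by
      intro x hx
      have hx1 : ¬ n * (ε / 2) ≤ |pathSum φ s (fun s a => Real.logb 2 (letterProb Q s a)) x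
          - n * ∑ t, ∑ a, Q t a * Real.logb 2 (letterProb Q t a)| := by
        simpa [hD₁] using (Finset.mem_filter.1 hx).2.2.1
      rw [hμ, seqProb_eq_rpow (hpos x hx)]
      refine Real.rpow_le_rpow_of_exponent_le (by norm_num) ?_
      rw [condEntropy]
      have := (abs_lt.1 (not_le.1 hx1)).2
      linarith
    have hcard : 1 / 2 ≤ T.card * (2 : ℝ) ^ (-(n * (condEntropy Q - ε / 2))) := by
      rw [← nsmul_eq_mul, ← Finset.sum_const]
      exact hmass.trans (Finset.sum_le_sum hup)
    calc (2 : ℝ) ^ (n * (condEntropy Q - ε))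
        ≤ 2 ^ (n * (condEntropy Q - ε / 2) - 1) :=
          Real.rpow_le_rpow_of_exponent_le (by norm_num) (by linarith)
      _ = 1 / 2 * 2 ^ (n * (condEntropy Q - ε / 2)) := by
          rw [Real.rpow_sub two_pos, Real.rpow_one]
          ring
      _ ≤ T.card * (2 : ℝ) ^ (-(n * (condEntropy Q - ε / 2)))
            * 2 ^ (n * (condEntropy Q - ε / 2)) :=
          mul_le_mul_of_nonneg_right hcard (by positivity)
      _ = T.card := by
          rw [mul_assoc, ← Real.rpow_add two_pos]
          simp
  · have hx2 : ¬ n * ε ≤ |pathSum φ s (fun s a => Real.logb 2 (P s a)) x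
        - n * ∑ t, ∑ a, Q t a * Real.logb 2 (P t a)| := by
      simpa [hD₂] using (Finset.mem_filter.1 hx).2.2.2
    have hPpos : ∀ i, 0 < P (stateBefore φ s x i) (x i) := fun i =>
      lt_of_le_of_ne (hP _ _) fun h0 =>
        ((letterProb_pos_iff hpmf.1).1 (hpos x hx i)).ne' (hsupp _ _ h0.symm)
    rw [seqProb_eq_rpow hPpos]
    refine Real.rpow_le_rpow_of_exponent_le (by norm_num) ?_
    rw [crossEntropy]
    have := (abs_lt.1 (not_le.1 hx2)).1
    linarith

end TypicalSets

/-! ### Circulations and connected supports -/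

section Perturbation

variable {X S : Type*}

theorem PossibleStep.mono {φ : X → S → S} {P Q : S → X → ℝ} (hP : ∀ s x, 0 ≤ P s x)
    (hsupp : SupportedBy Q P) {s t : S} (h : PossibleStep φ Q s t) : PossibleStep φ P s t := by
  obtain ⟨x, hx, rfl⟩ := h
  exact ⟨x, lt_of_le_of_ne (hP s x) fun h0 => hx.ne' (hsupp s x h0.symm), rfl⟩

variable [Fintype X] [Fintype S] [DecidableEq S]

/-- Poincaré recurrence: a state of positive stationary probability can be reached from itself. -/
theorem transGen_self_of_stationary {φ : X → S → S} {Q : S → X → ℝ} (hQ : ∀ s x, 0 ≤ Q s x)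
    (hst : IsStationaryPMF φ Q) {s : S} (hs : 0 < ∑ x, Q s x) :
    Relation.TransGen (PossibleStep φ Q) s s := by
  classical
  by_contra hno
  -- Reachability from `s` never decreases along a step, and its mean increment is zero by
  -- stationarity; yet a step out of a non-returning `s` raises it from 0 to 1.
  set h : S → ℝ := fun t => if Relation.TransGen (PossibleStep φ Q) s t then 1 else 0 with hh
  have h0 : ∑ t, ∑ x, Q t x * (h (φ x t) - h t) = 0 := by
    have h1 := sum_mul_imbalance φ Q h
    rw [Finset.sum_eq_zero fun t _ => by rw [(isStationaryPMF_iff φ Q).1 hst t, mul_zero]] at h1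
    rw [← neg_eq_zero, ← Finset.sum_neg_distrib, h1]
    refine Finset.sum_congr rfl fun t _ => ?_
    rw [← Finset.sum_neg_distrib]
    exact Finset.sum_congr rfl fun x _ => by ring
  have hnn : ∀ t x, 0 ≤ Q t x * (h (φ x t) - h t) := by
    intro t x
    rcases (hQ t x).eq_or_lt with hz | hz
    · rw [← hz, zero_mul]
    · refine mul_nonneg hz.le (sub_nonneg.2 ?_)
      by_cases ht : Relation.TransGen (PossibleStep φ Q) s t
      · simp only [hh, if_pos ht, if_pos (ht.tail ⟨x, hz, rfl⟩), le_refl]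
      · simp only [hh, if_neg ht]
        split_ifs <;> norm_num
  obtain ⟨x, -, hx⟩ := (Finset.sum_pos_iff_of_nonneg fun x _ => hQ s x).1 hs
  refine h0.not_gt (Finset.sum_pos' (fun t _ => Finset.sum_nonneg fun x _ => hnn t x)
    ⟨s, Finset.mem_univ s, Finset.sum_pos' (fun x _ => hnn s x) ⟨x, Finset.mem_univ x, ?_⟩⟩)
  have h1 : h s = 0 := if_neg hno
  have h2 : h (φ x s) = 1 := if_pos (Relation.TransGen.single ⟨x, hx, rfl⟩)
  rw [h1, h2]
  simpa using hx

theorem imbalance_add (φ : X → S → S) (N M : S → X → ℝ) (u : S) :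
    imbalance φ (N + M) u = imbalance φ N u + imbalance φ M u := by
  simp only [imbalance, Pi.add_apply, ite_add_zero, Finset.sum_add_distrib]
  ring

theorem imbalance_smul (φ : X → S → S) (c : ℝ) (N : S → X → ℝ) (u : S) :
    imbalance φ (c • N) u = c * imbalance φ N u := by
  simp only [imbalance, Pi.smul_apply, smul_eq_mul, mul_sub, Finset.mul_sum, mul_ite, mul_zero]

theorem imbalance_sum {ι : Type*} (φ : X → S → S) (I : Finset ι) (N : ι → S → X → ℝ) (u : S) :
    imbalance φ (∑ i ∈ I, N i) u = ∑ i ∈ I, imbalance φ (N i) u := by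
  classical
  induction I using Finset.induction_on with
  | empty => simp [imbalance]
  | insert i I hi ih => rw [Finset.sum_insert hi, Finset.sum_insert hi, imbalance_add, ih]

theorem exists_edge_flow (φ : X → S → S) {P : S → X → ℝ} {s : S} {x : X} (h : 0 < P s x) :
    ∃ N : S → X → ℝ, (∀ u a, 0 ≤ N u a) ∧ SupportedBy N P ∧ 0 < N s x ∧
      ∀ u, imbalance φ N u = (if u = s then 1 else 0) - if u = φ x s then 1 else 0 := by
  classical
  refine ⟨fun u a => if u = s ∧ a = x then 1 else 0, fun u a => by
    dsimp only
    split_ifs <;> norm_num,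
    fun u a hua => if_neg ?_, by simp, fun u => ?_⟩
  · rintro ⟨rfl, rfl⟩
    exact h.ne' hua
  · simp only [imbalance, ite_and]
    congr 1
    · by_cases hu : u = s <;> simp [hu]
    · rw [Finset.sum_eq_single s (fun t _ ht => by simp [ht]) (by simp),
        Finset.sum_eq_single x (fun a _ ha => by simp [ha]) (by simp)]
      simp [eq_comm]

theorem exists_path_flow (φ : X → S → S) {P : S → X → ℝ} {s t : S}
    (h : Relation.TransGen (PossibleStep φ P) s t) :
    ∃ N : S → X → ℝ, (∀ u a, 0 ≤ N u a) ∧ SupportedBy N P ∧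
      ∀ u, imbalance φ N u = (if u = s then 1 else 0) - if u = t then 1 else 0 := by
  induction h with
  | single h =>
    obtain ⟨x, hx, rfl⟩ := h
    obtain ⟨N, h1, h2, -, h4⟩ := exists_edge_flow φ hx
    exact ⟨N, h1, h2, h4⟩
  | tail _ h ih =>
    obtain ⟨x, hx, rfl⟩ := h
    obtain ⟨N, h1, h2, -, h4⟩ := exists_edge_flow φ hx
    obtain ⟨M, k1, k2, k4⟩ := ih
    refine ⟨M + N, fun u a => add_nonneg (k1 u a) (h1 u a), fun u a hua => ?_, fun u => ?_⟩
    · simp [k2 u a hua, h2 u a hua]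
    · rw [imbalance_add, k4, h4]
      ring

/-- A circulation through all possible steps between recurrent states. -/
theorem exists_full_circulation {φ : X → S → S} {P : S → X → ℝ}
    (hirr : IsIrreducibleSource φ P) :
    ∃ M : S → X → ℝ, (∀ u a, 0 ≤ M u a) ∧ SupportedBy M P ∧ (∀ u, imbalance φ M u = 0) ∧
      ∀ s x, Relation.TransGen (PossibleStep φ P) s s → 0 < P s x → 0 < M s x := by
  have key : ∀ z : S × X, ∃ N : S → X → ℝ, (∀ u a, 0 ≤ N u a) ∧ SupportedBy N P ∧
      (∀ u, imbalance φ N u = 0) ∧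
      (Relation.TransGen (PossibleStep φ P) z.1 z.1 → 0 < P z.1 z.2 → 0 < N z.1 z.2) := by
    rintro ⟨s, x⟩
    by_cases h : Relation.TransGen (PossibleStep φ P) s s ∧ 0 < P s x
    · obtain ⟨N, h1, h2, h3, h4⟩ := exists_edge_flow φ h.2
      -- Irreducibility closes the edge to a cycle through the recurrent state `s`.
      obtain ⟨M, k1, k2, k4⟩ := exists_path_flow φ (hirr (φ x s) s h.1)
      refine ⟨M + N, fun u a => add_nonneg (k1 u a) (h1 u a), fun u a hua => ?_, fun u => ?_,
        fun _ _ => add_pos_of_nonneg_of_pos (k1 s x) h3⟩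
      · simp [k2 u a hua, h2 u a hua]
      · rw [imbalance_add, k4, h4]
        ring
    · exact ⟨0, fun _ _ => le_rfl, fun _ _ _ => rfl, fun u => by simp [imbalance],
        fun h1 h2 => absurd ⟨h1, h2⟩ h⟩
  choose N h1 h2 h3 h4 using key
  refine ⟨∑ z, N z, fun u a => ?_, fun u a hua => ?_, fun u => ?_, fun s x hs hx => ?_⟩
  · simp only [Finset.sum_apply]
    exact Finset.sum_nonneg fun z _ => h1 z u a
  · simp only [Finset.sum_apply]
    exact Finset.sum_eq_zero fun z _ => h2 z u a hua
  · rw [imbalance_sum]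
    exact Finset.sum_eq_zero fun z _ => h3 z u
  · simp only [Finset.sum_apply]
    exact Finset.sum_pos' (fun z _ => h1 z s x) ⟨(s, x), Finset.mem_univ _, h4 (s, x) hs hx⟩

/-- Every stationary PMF can be approximated by stationary PMFs with connected support, without
losing much in the exponent. -/
theorem exists_connected_approximation {φ : X → S → S} {P : S → X → ℝ} (hP : ∀ s x, 0 ≤ P s x)
    (hirr : IsIrreducibleSource φ P) (R ρ : ℝ) {Q : S → X → ℝ} (hQ : Q ∈ stationaryPMFs φ P)
    {ε : ℝ} (hε : 0 < ε) :
    ∃ Q' ∈ stationaryPMFs φ P, exponentAt P R ρ Q - ε < exponentAt P R ρ Q' ∧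
      ∀ s t, 0 < ∑ x, Q' s x → 0 < ∑ x, Q' t x →
        Relation.ReflTransGen (PossibleStep φ Q') s t := by
  obtain ⟨M, hM0, hMP, hMb, hMpos⟩ := exists_full_circulation hirr
  obtain ⟨⟨⟨hQ0, hQ1⟩, hQP⟩, hQst⟩ := hQ
  set c : ℝ := ∑ s, ∑ x, M s x with hc
  have hc0 : 0 ≤ c := Finset.sum_nonneg fun s _ => Finset.sum_nonneg fun x _ => hM0 s x
  -- The circulation is balanced, so the normalized mixture stays stationary and tends to `Q` as `δ`
  -- tends to 0.
  set q : ℝ → S → X → ℝ := fun δ => (1 + δ * c)⁻¹ • (Q + δ • M) with hq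
  have hqapp : ∀ δ s x, q δ s x = (1 + δ * c)⁻¹ * (Q s x + δ * M s x) := fun _ _ _ => rfl
  have hqnn : ∀ δ, 0 ≤ δ → ∀ s x, 0 ≤ q δ s x := fun δ hδ s x => by
    rw [hqapp]
    have h1 := hQ0 s x
    have h2 := hM0 s x
    positivity
  have hmem : ∀ δ, 0 ≤ δ → q δ ∈ stationaryPMFs φ P := by
    intro δ hδ
    have hden : 1 + δ * c ≠ 0 := by positivity
    refine ⟨⟨⟨hqnn δ hδ, ?_⟩, fun s x hsx => ?_⟩, ?_⟩
    · simp only [hqapp, ← Finset.mul_sum, Finset.sum_add_distrib, hQ1, ← hc]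
      exact inv_mul_cancel₀ hden
    · rw [hqapp, hQP s x hsx, hMP s x hsx]
      simp
    · rw [isStationaryPMF_iff]
      intro t
      rw [hq, imbalance_smul, imbalance_add, imbalance_smul, hMb,
        (isStationaryPMF_iff φ Q).1 hQst t]
      simp
  have hq0 : q 0 = Q := by
    funext s x
    simp [hqapp]
  have hcont : Tendsto (fun δ => exponentAt P R ρ (q δ)) (𝓝[>] 0) (𝓝 (exponentAt P R ρ Q)) := by
    have h1 : ContinuousAt q 0 := by
      refine continuousAt_pi.2 fun s => continuousAt_pi.2 fun x => ?_
      simp only [hqapp]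
      exact ContinuousAt.mul (ContinuousAt.inv₀ (by fun_prop) (by simp)) (by fun_prop)
    have h2 : Tendsto q (𝓝[>] 0) (𝓝[{Q | ∀ s x, 0 ≤ Q s x}] Q) := by
      refine tendsto_nhdsWithin_iff.2 ⟨?_, ?_⟩
      · rw [← hq0]
        exact h1.tendsto.mono_left nhdsWithin_le_nhds
      · filter_upwards [self_mem_nhdsWithin] with δ hδ
        exact hqnn δ (le_of_lt hδ)
    exact (continuousOn_exponentAt P R ρ Q hQ0).tendsto.comp h2
  obtain ⟨δ, hδε, hδ⟩ := ((hcont.eventually (lt_mem_nhds (sub_lt_self _ hε))).and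
    self_mem_nhdsWithin).exists
  have hδ0 : (0 : ℝ) < δ := hδ
  refine ⟨q δ, hmem δ hδ0.le, hδε, fun s t hs ht => ?_⟩
  have hrec : ∀ u, 0 < ∑ x, q δ u x → Relation.TransGen (PossibleStep φ P) u u := fun u hu =>
    (transGen_self_of_stationary (hqnn δ hδ0.le) (hmem δ hδ0.le).2 hu).lift id
      fun _ _ => PossibleStep.mono hP (hmem δ hδ0.le).1.2
  -- A `P`-path from a recurrent state visits only recurrent states, whose possible steps are all
  -- charged by `q δ`.
  have hlift : ∀ u, Relation.TransGen (PossibleStep φ P) u u →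
      ∀ v, Relation.TransGen (PossibleStep φ P) u v →
      Relation.ReflTransGen (PossibleStep φ (q δ)) u v ∧
        Relation.TransGen (PossibleStep φ P) v v := by
    have hedge : ∀ u v, Relation.TransGen (PossibleStep φ P) u u → PossibleStep φ P u v →
        PossibleStep φ (q δ) u v := by
      rintro u v hu ⟨x, hx, rfl⟩
      refine ⟨x, ?_, rfl⟩
      rw [hqapp]
      have h1 := hMpos u x hu hx
      have h2 := hQ0 u x
      positivity
    intro u hu v huv
    induction huv with
    | single h =>
      exact ⟨.single (hedge _ _ hu h), (hirr _ _ hu).tail h⟩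
    | tail _ h ih =>
      exact ⟨ih.1.tail (hedge _ _ ih.2 h), (hirr _ _ ih.2).tail h⟩
  exact (hlift s (hrec s hs) t (hirr s t (hrec t ht))).1

end Perturbation

/-! ### The lower bound on the exponent -/

section LowerBound

variable {X S : Type*} [Fintype X]

theorem eventually_exists_cipher_ge {φ : X → S → S} {P : S → X → ℝ} (hP : ∀ s x, 0 ≤ P s x)
    {a b R ρ : ℝ} (hρ : 0 ≤ ρ) {s : S} (ht : HasTypicalSets φ P a b s) {k : ℕ → ℕ}
    (hk : Tendsto (fun n => (k n : ℝ) / (n : ℝ)) atTop (𝓝 R)) {ε : ℝ} (hε : 0 < ε) :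
    ∀ᶠ n : ℕ in atTop, ∃ c : Cipher X n (k n), ∀ G, IsGuessing G →
      ρ * min a R + a - b - ε
        ≤ (1 / (n : ℝ)) * Real.logb 2 (guessMoment (seqProb φ s P) c ρ G) := by
  -- The losses are `η` each in message probability and in the size of `T`, `ρ η` in the minimum,
  -- and `(2 + 2 ρ) / n < η` from the divisions by 4.
  set η : ℝ := ε / (4 * (1 + ρ)) with hη
  have hη0 : 0 < η := by positivity
  have hηε : 4 * (η + ρ * η) = ε := by
    rw [hη]
    field_simp
  have hconst : Tendsto (fun n : ℕ => (2 + 2 * ρ) / (n : ℝ)) atTop (𝓝 0) :=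
    tendsto_const_div_atTop_nhds_zero_nat _
  filter_upwards [ht η hη0, hk.eventually (lt_mem_nhds (sub_lt_self R hη0)),
    hconst.eventually (gt_mem_nhds hη0), eventually_gt_atTop 0] with n ⟨T, hT, hTp⟩ hkn hcn hn0
  have hn : (0 : ℝ) < n := by positivity
  have hTne : T.Nonempty := by
    rw [← Finset.card_pos]
    exact_mod_cast (show (0 : ℝ) < 2 ^ (n * (a - η)) by positivity).trans_le hT
  obtain ⟨c, hc⟩ := exists_cipher_guessMoment_ge (k n) hTne (seqProb_nonneg (s := s) hP)
    (Real.rpow_nonneg two_pos.le _) hTp hρ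
  refine ⟨c, fun G hG => ?_⟩
  have hmin : (2 : ℝ) ^ (n * (min a R - η)) ≤ min ((2 : ℝ) ^ k n) T.card := by
    refine le_min ?_ (le_trans (Real.rpow_le_rpow_of_exponent_le (by norm_num) ?_) hT)
    · rw [← Real.rpow_natCast]
      refine Real.rpow_le_rpow_of_exponent_le (by norm_num) ?_
      rw [lt_div_iff₀ hn] at hkn
      nlinarith [min_le_right a R]
    · exact mul_le_mul_of_nonneg_left (by linarith [min_le_left a R]) hn.le
  have hlow : (2 : ℝ) ^ (-(n * (b + η))) * ((2 : ℝ) ^ (n * (a - η)) / 4)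
      * ((2 : ℝ) ^ (n * (min a R - η)) / 4) ^ ρ ≤ guessMoment (seqProb φ s P) c ρ G := by
    refine le_trans ?_ (hc G hG)
    gcongr
  have hlog := Real.logb_le_logb_of_le (by norm_num : (1 : ℝ) < 2) (by positivity) hlow
  have h4 : Real.logb 2 4 = 2 := by
    rw [show (4 : ℝ) = 2 ^ (2 : ℝ) by norm_num, Real.logb_rpow two_pos (by norm_num)]
  have hquot : ∀ z : ℝ, Real.logb 2 ((2 : ℝ) ^ z / 4) = z - 2 := fun z => by
    rw [Real.logb_div (by positivity) (by norm_num), h4, Real.logb_rpow two_pos (by norm_num)]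
  rw [Real.logb_mul (by positivity) (by positivity), Real.logb_mul (by positivity) (by positivity),
    Real.logb_rpow two_pos (by norm_num), hquot,
    Real.logb_rpow_eq_mul_logb_of_pos (by positivity), hquot] at hlog
  rw [div_lt_iff₀ hn] at hcn
  rw [one_div, le_inv_mul_iff₀ hn]
  have hnη : 0 ≤ n * (η + ρ * η) := by positivity
  have hnρη : 0 ≤ n * (ρ * η) := by positivity
  rw [← hηε]
  nlinarith

theorem tendsto_of_eventually_between {u : ℕ → ℝ} {E : ℝ}
    (hl : ∀ ε > 0, ∀ᶠ n in atTop, E - ε ≤ u n) (hu : ∀ ε > 0, ∀ᶠ n in atTop, u n ≤ E + ε) :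
    Tendsto u atTop (𝓝 E) := by
  refine tendsto_order.2 ⟨fun a ha => ?_, fun a ha => ?_⟩
  · filter_upwards [hl ((E - a) / 2) (by linarith)] with n hn
    linarith
  · filter_upwards [hu ((a - E) / 2) (by linarith)] with n hn
    linarith

/-- There are infinitely many ciphers, so the real supremum needs a uniform bound: no guess number
exceeds the number of messages. -/
theorem le_iSup_of_cipher {n k : ℕ} {p : (Fin n → X) → ℝ} (hp : ∀ x, 0 ≤ p x) (hp1 : ∑ x, p x = 1)
    {ρ : ℝ} (hρ : 0 ≤ ρ) {G : Cipher X n k → List Bool → (Fin n → X) → ℕ}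
    (hG : ∀ c, IsGuessing (G c)) (c : Cipher X n k) :
    (1 / (n : ℝ)) * Real.logb 2 (guessMoment p c ρ (G c))
      ≤ ⨆ c : Cipher X n k, (1 / (n : ℝ)) * Real.logb 2 (guessMoment p c ρ (G c)) := by
  refine le_ciSup (f := fun c => (1 / (n : ℝ)) * Real.logb 2 (guessMoment p c ρ (G c)))
    ⟨(1 / (n : ℝ)) * Real.logb 2 ((Fintype.card (Fin n → X) : ℝ) ^ ρ), ?_⟩ c
  rintro _ ⟨c, rfl⟩
  exact logb_guessMoment_le hp hp1 c hρ (hG c)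

end LowerBound

/-! ### The two limits -/

theorem theorem1 {X S : Type*} [Fintype X] [Fintype S] [DecidableEq X] [DecidableEq S]
    (φ : X → S → S) (hφ : IsUnifilarMap φ) (s₀ : S)
    (P : S → X → ℝ) (hP : IsLetterLaw P) (hirr : IsIrreducibleSource φ P)
    (R ρ : ℝ) (hR : 0 < R) (hρ : 0 < ρ)
    (k : ℕ → ℕ) (hk : Tendsto (fun n => (k n : ℝ) / (n : ℝ)) atTop (𝓝 R)) :
    ∃ E : ℝ, IsGreatest (exponentValues φ P R ρ) (E : EReal) ∧
      Tendsto (fun n => optimalExponent n (k n) (seqProb φ s₀ P) ρ) atTop (𝓝 E) ∧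
      ∀ (ms : ∀ n, List (Fin n → X)) (ks : ∀ n, List (Fin (k n) → Bool)),
        (∀ n, IsMDLOrder φ s₀ (ms n)) → (∀ n, IsEnumeration (ks n)) →
        Tendsto (fun n => interlacedExponent n (k n) (seqProb φ s₀ P) ρ (ms n) (ks n))
          atTop (𝓝 E) := by
  have hP0 : ∀ s x, 0 ≤ P s x := fun s => (hP s).1
  have hp0 : ∀ n, ∀ x : Fin n → X, 0 ≤ seqProb φ s₀ P x := fun n => seqProb_nonneg hP0
  have hp1 : ∀ n, ∑ x : Fin n → X, seqProb φ s₀ P x = 1 := fun n => sum_seqProb φ hP n s₀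
  obtain ⟨Q, hQ, hmax⟩ := exists_maximizer φ s₀ hP R ρ
  set E := exponentAt P R ρ Q with hE
  -- The cipher is chosen before the strategy, so the same bound serves both the Bayes and the
  -- interlaced attack.
  have hlower : ∀ ε > 0, ∀ᶠ n : ℕ in atTop, ∃ c : Cipher X n (k n), ∀ G, IsGuessing G →
      E - ε ≤ (1 / (n : ℝ)) * Real.logb 2 (guessMoment (seqProb φ s₀ P) c ρ G) := by
    intro ε hε
    obtain ⟨Q', hQ', hlt, hconn⟩ := exists_connected_approximation hP0 hirr R ρ hQ (half_pos hε)
    obtain ⟨t, -, ht⟩ : ∃ t ∈ Finset.univ, 0 < ∑ x, Q' t x := by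
      refine (Finset.sum_pos_iff_of_nonneg fun t _ =>
        Finset.sum_nonneg fun x _ => hQ'.1.1.1 t x).1 ?_
      rw [hQ'.1.1.2]
      exact one_pos
    have hreach : Relation.TransGen (PossibleStep φ P) s₀ t := hirr s₀ t
      ((transGen_self_of_stationary hQ'.1.1.1 hQ'.2 ht).lift id
        fun _ _ => PossibleStep.mono hP0 hQ'.1.2)
    have htyp := (hasTypicalSets_of_stationary hP0 hQ' hconn ht).of_reachable hreach
    filter_upwards [eventually_exists_cipher_ge hP0 hρ.le htyp hk (half_pos hε)] with n ⟨c, hc⟩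
    refine ⟨c, fun G hG => le_trans ?_ (hc G hG)⟩
    rw [exponentAt.eq_1 P R ρ Q'] at hlt
    linarith
  -- `ciSup_le` requires a nonempty index type.
  have hne : ∀ᶠ n in atTop, Nonempty (Cipher X n (k n)) :=
    (hlower 1 one_pos).mono fun n ⟨c, _⟩ => ⟨c⟩
  refine ⟨E, isGreatest_exponentValues hQ hmax, tendsto_of_eventually_between ?_ ?_, ?_⟩
  · intro ε hε
    filter_upwards [hlower ε hε] with n ⟨c, hc⟩
    exact (hc _ (isGuessing_bayesGuess _ c)).trans
      (le_iSup_of_cipher (hp0 n) (hp1 n) hρ.le (isGuessing_bayesGuess _) c)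
  · intro ε hε
    filter_upwards [eventually_interlaced_le s₀ hP hρ.le hk hmax hε, hne] with n hn hne
    refine ciSup_le fun c => ?_
    obtain ⟨ms, hms⟩ := exists_isMDLOrder φ s₀ n
    obtain ⟨ks, hks⟩ := exists_isEnumeration (Fin (k n) → Bool)
    refine le_trans (mul_le_mul_of_nonneg_left ?_ (by positivity)) (hn ms ks hms hks c)
    exact Real.logb_le_logb_of_le (by norm_num)
      (zero_lt_one.trans_le (one_le_guessMoment (hp0 n) (hp1 n) c hρ.le (isGuessing_bayesGuess _ c)))
      (guessMoment_bayesGuess_le (hp0 n) c hρ.le (isGuessing_interlacedGuess hms.1 ks c))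
  · intro ms ks hms hks
    refine tendsto_of_eventually_between (fun ε hε => ?_) fun ε hε => ?_
    · filter_upwards [hlower ε hε] with n ⟨c, hc⟩
      have hG := isGuessing_interlacedGuess (k := k n) (hms n).1 (ks n)
      exact (hc _ (hG c)).trans (le_iSup_of_cipher (hp0 n) (hp1 n) hρ.le hG c)
    · filter_upwards [eventually_interlaced_le s₀ hP hρ.le hk hmax hε, hne] with n hn hne
      exact ciSup_le fun c => hn (ms n) (ks n) (hms n) (hks n) c

end
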